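/- Let $\xi=(\xi_s)_{s\ge 0}$ be a one-dimensional Lévy process on a probability space $(\Omega,\mathcal F,\mathbb P)$ (that is, $\xi_0=0$ almost surely, $\xi$ has stationary and independent increments, and its paths are almost surely right-continuous) such that $\lim_{s\to\infty}\xi_s=+\infty$ almost surely. Let $U(dy)=\int_0^\infty \mathbb P(\xi_s\in dy)\,ds$ be its potential measure. Let $f:\mathbb R\to[0,\infty)$ be measurable and locally bounded, and suppose that $f$ is either continuous or ultimately non-increasing (i.e. non-increasing on $[l,\infty)$ for some $l\in\mathbb R$). Let $x\in\mathbb R$. For a Borel set $E\subseteq\mathbb R$, the complement $\mathbb R\setminus E$ is called $\mathbb P^x$-transient if $$\mathbb P\bigl(\exists\,\tau\ge 0:\ x+\xi_s\in E\ \text{ for all } s\ge\tau\bigr)=1 .$$ Then $$\mathbb P\Bigl(\int_0^\infty f(x+\xi_s)\,ds<\infty\Bigr)=0\iff \int_{\{y\,:\,x+y\in E\}} f(x+y)\,U(dy)=\infty\ \text{ for every Borel set } E \text{ such that } \mathbb R\setminus E \text{ is } \mathbb P^x\text{-transient}.$$ Otherwise, that is, if $\int_{\{y\,:\,x+y\in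 E\}} f(x+y)\,U(dy)<\infty$ for some Borel set $E$ such that $\mathbb R\setminus E$ is $\mathbb P^x$-transient, then $\int_0^\infty f(x+\xi_s)\,ds<\infty$ almost surely. -/

import Mathlib

open MeasureTheory ProbabilityTheory Filter Topology
open scoped NNReal ENNReal

/-- `ξ` is a one-dimensional Lévy process under the probability measure `P`: it starts at `0`, has
stationary and independent increments, and almost surely has right-continuous paths. -/
structure IsLevyProcess {Ω : Type*} [MeasurableSpace Ω] (ξ : ℝ≥0 → Ω → ℝ) (P : Measure Ω) :
    Prop where
  measurable : ∀ t, Measurable (ξ t)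
  start_zero : ∀ᵐ ω ∂P, ξ 0 ω = 0
  indep_increments : HasIndepIncrements ξ P
  stationary_increments : ∀ s t, P.map (fun ω => ξ (s + t) ω - ξ s ω) = P.map (ξ t)
  right_continuous : ∀ᵐ ω ∂P, ∀ t, ContinuousWithinAt (fun s => ξ s ω) (Set.Ici t) t

/-- The process drifts to `+∞` almost surely. -/
def DriftsToInfinity {Ω : Type*} [MeasurableSpace Ω] (ξ : ℝ≥0 → Ω → ℝ) (P : Measure Ω) : Prop :=
  ∀ᵐ ω ∂P, Tendsto (fun s => ξ s ω) atTop atTop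

/-- The potential measure `U(dy) = ∫₀^∞ P(ξ_s ∈ dy) ds`. -/
noncomputable def potentialMeasure {Ω : Type*} [MeasurableSpace Ω] (ξ : ℝ≥0 → Ω → ℝ)
    (P : Measure Ω) : Measure ℝ :=
  (volume.restrict (Set.Ici (0 : ℝ))).bind (fun s => P.map (ξ s.toNNReal))

/-- The laws of `ξ_t` depend measurably on `t`, so the mixture in `potentialMeasure` is meaningful. -/
lemma measurable_law {Ω : Type*} [MeasurableSpace Ω] {ξ : ℝ≥0 → Ω → ℝ} {P : Measure Ω}
    [IsProbabilityMeasure P] (h : IsLevyProcess ξ P) : Measurable fun t => P.map (ξ t) := by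
  have hprob : ∀ t, IsProbabilityMeasure (P.map (ξ t)) := fun t =>
    Measure.isProbabilityMeasure_map (h.measurable t).aemeasurable
  let a : ℕ → ℝ≥0 → ℝ≥0 := fun n s => ((⌊((n : ℝ≥0) + 1) * s⌋₊ : ℝ≥0) + 1) / ((n : ℝ≥0) + 1)
  have ha1 : ∀ n s, s ≤ a n s := fun n s => by
    rw [le_div_iff₀ (by positivity), mul_comm]
    exact (Nat.lt_floor_add_one _).le
  have ha2 : ∀ n s, a n s ≤ s + 1 / ((n : ℝ≥0) + 1) := fun n s => by
    have hn : ((n : ℝ≥0) + 1) ≠ 0 := by positivity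
    have e : (s + 1 / ((n : ℝ≥0) + 1)) * ((n : ℝ≥0) + 1) = ((n : ℝ≥0) + 1) * s + 1 := by
      field_simp
    rw [div_le_iff₀ (by positivity), e]
    refine add_le_add_left ?_ 1
    exact Nat.floor_le (by positivity)
  have ha : ∀ s, Tendsto (fun n => a n s) atTop (𝓝[Set.Ici s] s) := fun s => by
    refine tendsto_nhdsWithin_iff.2 ⟨?_, Eventually.of_forall fun n => ha1 n s⟩
    refine tendsto_of_tendsto_of_tendsto_of_le_of_le tendsto_const_nhds ?_
      (fun n => ha1 n s) (fun n => ha2 n s)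
    simpa using (tendsto_const_nhds (x := s)).add
      (tendsto_one_div_add_atTop_nhds_zero_nat (𝕜 := ℝ≥0))
  have hint : ∀ g : BoundedContinuousFunction ℝ ℝ≥0, (∀ y, g y ≤ 1) →
      Measurable fun t => ∫⁻ y, g y ∂(P.map (ξ t)) := by
    intro g hg1
    refine measurable_of_tendsto_metrizable
      (f := fun n t => ∫⁻ y, g y ∂(P.map (ξ (a n t)))) (fun n => ?_) ?_
    · have : (fun t => ∫⁻ y, g y ∂(P.map (ξ (a n t)))) =
        (fun k : ℕ => ∫⁻ y, g y ∂(P.map (ξ (((k : ℝ≥0) + 1) / ((n : ℝ≥0) + 1))))) ∘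
          fun t : ℝ≥0 => ⌊((n : ℝ≥0) + 1) * t⌋₊ := rfl
      rw [this]
      exact (measurable_of_countable _).comp (Nat.measurable_floor.comp (by fun_prop))
    · rw [tendsto_pi_nhds]
      intro t
      have hg : Measurable fun y => (g y : ℝ≥0∞) := by fun_prop
      have e : ∀ s, ∫⁻ y, g y ∂(P.map (ξ s)) = ∫⁻ ω, g (ξ s ω) ∂P := fun s =>
        lintegral_map hg (h.measurable s)
      simp only [e]
      refine tendsto_lintegral_of_dominated_convergence (fun _ => (1 : ℝ≥0∞))
        (fun n => hg.comp (h.measurable _)) (fun n => Eventually.of_forall fun ω => ?_)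
        (by simp) ?_
      · exact ENNReal.coe_le_coe.2 (hg1 _)
      · filter_upwards [h.right_continuous] with ω hω
        have := (hω t).tendsto.comp (ha t)
        exact ENNReal.tendsto_coe.2 ((g.continuous.tendsto _).comp this)
  refine Measurable.measure_of_isPiSystem_of_isProbabilityMeasure
    (S := {s : Set ℝ | IsClosed s}) ?_ isPiSystem_isClosed ?_
  · rw [← borel_eq_generateFrom_isClosed]; exact BorelSpace.measurable_eq
  · intro F hF
    refine measurable_of_tendsto_metrizable
      (f := fun n t => ∫⁻ y, hF.apprSeq n y ∂(P.map (ξ t))) (fun n => hint _ (HasOuterApproxClosed.apprSeq_apply_le_one hF n)) ?_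
    rw [tendsto_pi_nhds]
    intro t
    exact HasOuterApproxClosed.tendsto_lintegral_apprSeq hF (P.map (ξ t))

/-- `U(A) = ∫₀^∞ P(ξ_s ∈ A) ds` for Borel sets `A`. -/
lemma potentialMeasure_apply {Ω : Type*} [MeasurableSpace Ω] {ξ : ℝ≥0 → Ω → ℝ} {P : Measure Ω}
    [IsProbabilityMeasure P] (h : IsLevyProcess ξ P) {A : Set ℝ} (hA : MeasurableSet A) :
    potentialMeasure ξ P A = ∫⁻ s in Set.Ici (0 : ℝ), P {ω | ξ s.toNNReal ω ∈ A} := by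
  have hm : Measurable fun s : ℝ => P.map (ξ s.toNNReal) :=
    (measurable_law h).comp measurable_real_toNNReal
  rw [potentialMeasure, Measure.bind_apply hA hm.aemeasurable]
  simp only [Measure.map_apply (h.measurable _) hA]
  rfl

/-- The set `A` is `P^x`-transient, where `P^x` is the law of `x + ξ`: it is Borel, and almost
surely `x + ξ` stays in the complement of `A` from some finite time on. -/
def IsTransientSet {Ω : Type*} [MeasurableSpace Ω] (ξ : ℝ≥0 → Ω → ℝ) (P : Measure Ω) (x : ℝ)
    (A : Set ℝ) : Prop :=
  MeasurableSet A ∧ ∀ᵐ ω ∂P, ∃ τ : ℝ≥0, ∀ s, τ ≤ s → x + ξ s ω ∈ Aᶜ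

/-- The perpetual integral `∫₀^∞ f(x + ξ_s) ds ∈ [0, ∞]` along the path of `ω`. -/
noncomputable def perpetualIntegral {Ω : Type*} (f : ℝ → ℝ≥0) (ξ : ℝ≥0 → Ω → ℝ) (x : ℝ) (ω : Ω) :
    ℝ≥0∞ :=
  ∫⁻ s in Set.Ici (0 : ℝ), (f (x + ξ s.toNNReal ω) : ℝ≥0∞)

/-- `f` is bounded in a neighbourhood of every point. -/
def LocallyBounded (f : ℝ → ℝ≥0) : Prop :=
  ∀ a, ∃ C : ℝ≥0, ∀ᶠ y in 𝓝 a, f y ≤ C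

/-- `f` is non-increasing on some half-line `[l, ∞)`. -/
def UltimatelyNonincreasing (f : ℝ → ℝ≥0) : Prop :=
  ∃ l : ℝ, AntitoneOn f (Set.Ici l)

/-! Write `I_y` for the perpetual integral started at `y`. Every path property used holds off a null
set, so ξ may be taken right-continuous everywhere with value 0 at time 0
(`IsLevyProcess.exists_isRegularLevy`).

If the potential of f is finite on E, Tonelli makes the time integral of `1_E f` along the path
almost surely finite. Once the path stays in E this is the whole tail of `I_x`; the initial piece is
finite because f is locally bounded and paths are bounded on bounded times (`ae_locally_bounded`).

Conversely, let `I_x` be finite with positive probability and put `E = {y : P(I_y ≤ K) ≥ c}`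
(intersected with a half-line in the monotone case). By the Markov property, `c ∫_E f dU` is at most
the expected integral of f over the times whose remaining integral is at most K. Path by path that
integral is at most K, so the potential on E is at most `K / c`
(`mul_setLIntegral_potentialMeasure_le`). It remains to see that the path eventually stays in E.

If f is ultimately non-increasing, it can be truncated to be non-increasing; then `P(I_y ≤ K)`
increases with y, and drift to infinity finishes (`exists_of_antitoneOn`).

If f is continuous, a zero-one law comes first: `y ↦ P(I_y < ∞)` is harmonic for every `ξ_t`, so by
Choquet–Deny it is almost surely constant along the path, which forces its value at x to be 1
(`ae_perpetualIntegral_lt_top_of_pos`). The tails therefore tend to 0. With `K = 1` and `c = 1/2`,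
each visit outside E after time m makes the tail at m exceed 1 with conditional probability at least
1/2; a maximal inequality shows that such late visits have vanishing probability
(`exists_of_continuous`). -/

/-- A finite set of nonnegative times is covered by a monotone sequence which starts at `0`. -/
lemma exists_monotone_nat_cover (F : Finset ℝ≥0) :
    ∃ t : ℕ → ℝ≥0, Monotone t ∧ t 0 = 0 ∧ ∀ s ∈ F, ∃ k, t k = s := by
  classical
  set G := insert 0 F with hG
  have hc : 0 < G.card := Finset.card_pos.2 ⟨0, by simp [hG]⟩
  let e := G.orderEmbOfFin rfl
  have hr : ∀ s ∈ G, ∃ i, e i = s := fun s hs => by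
    have : s ∈ Set.range e := by
      rw [Finset.range_orderEmbOfFin]; exact hs
    exact this
  -- The sequence enumerates `G` increasingly and then stays at its last element.
  refine ⟨fun k => e ⟨min k (G.card - 1), by omega⟩, fun a b hab => ?_, ?_, fun s hs => ?_⟩
  · exact e.monotone (by simp only [Fin.mk_le_mk]; omega)
  · obtain ⟨i, hi⟩ := hr 0 (by simp [hG])
    refine le_antisymm ?_ zero_le
    rw [← hi]
    exact e.monotone (by simp [Fin.le_def])
  · obtain ⟨i, hi⟩ := hr s (by simp [hG, hs])
    refine ⟨i, ?_⟩
    rw [← hi]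
    have := i.2
    exact congrArg e (Fin.ext (by simp only; omega))

/-! ### Regular Lévy processes and the simple Markov property -/

/-- A Lévy process all of whose paths start at `0` and are right-continuous. -/
structure IsRegularLevy {Ω : Type*} [MeasurableSpace Ω] (ξ : ℝ≥0 → Ω → ℝ) (P : Measure Ω) :
    Prop extends toLevy : IsLevyProcess ξ P where
  zero : ∀ ω, ξ 0 ω = 0
  continuousWithinAt : ∀ ω t, ContinuousWithinAt (fun s => ξ s ω) (Set.Ici t) t

/-- The increments of a process after time `s`. -/
def laterIncrement {Ω : Type*} (ξ : ℝ≥0 → Ω → ℝ) (s : ℝ≥0) : ℝ≥0 → Ω → ℝ :=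
  fun t ω => ξ (s + t) ω - ξ s ω

lemma sum_range_increments {Ω : Type*} (ξ : ℝ≥0 → Ω → ℝ) (t : ℕ → ℝ≥0) (ω : Ω) (k : ℕ) :
    ∑ i ∈ Finset.range k, (ξ (t (i + 1)) ω - ξ (t i) ω) = ξ (t k) ω - ξ (t 0) ω :=
  Finset.sum_range_sub (fun i => ξ (t i) ω) k

section Markov

variable {Ω : Type*} [MeasurableSpace Ω] {P : Measure Ω} {ξ : ℝ≥0 → Ω → ℝ}

namespace IsRegularLevy

lemma map_increment (h : IsRegularLevy ξ P) {s t : ℝ≥0} (hst : s ≤ t) :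
    P.map (fun ω => ξ t ω - ξ s ω) = P.map (ξ (t - s)) := by
  have := h.stationary_increments s (t - s)
  rwa [add_tsub_cancel_of_le hst] at this

lemma laterIncrement (h : IsRegularLevy ξ P) (s : ℝ≥0) : IsRegularLevy (laterIncrement ξ s) P where
  measurable t := (h.measurable _).sub (h.measurable _)
  start_zero := by simp [_root_.laterIncrement]
  zero := by simp [_root_.laterIncrement]
  indep_increments n t ht := by
    have := h.indep_increments n (fun i => s + t i) (fun i j hij => add_le_add_right (ht hij) s)
    simpa [_root_.laterIncrement] using this
  stationary_increments r t := by
    have e1 : (fun ω => _root_.laterIncrement ξ s (r + t) ω - _root_.laterIncrement ξ s r ω) =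
        fun ω => ξ ((s + r) + t) ω - ξ (s + r) ω := by
      ext ω; simp [_root_.laterIncrement, add_assoc]
    rw [e1, h.stationary_increments]
    exact (h.stationary_increments s t).symm
  continuousWithinAt ω t := by
    refine ContinuousWithinAt.sub ?_ continuousWithinAt_const
    exact (h.continuousWithinAt ω (s + t)).comp (f := fun r => s + r)
      (by fun_prop) (fun r hr => by simpa using hr)
  right_continuous := Eventually.of_forall fun ω t => by
    refine ContinuousWithinAt.sub ?_ continuousWithinAt_const
    exact (h.continuousWithinAt ω (s + t)).comp (f := fun r => s + r)
      (by fun_prop) (fun r hr => by simpa using hr)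

/-- The process stopped at `s` is independent of the increments after `s`. -/
lemma indepFun_laterIncrement [IsProbabilityMeasure P] (h : IsRegularLevy ξ P) (s : ℝ≥0) :
    IndepFun (fun ω t => ξ (min t s) ω) (fun ω t => _root_.laterIncrement ξ s t ω) P := by
  classical
  refine IndepFun.process_indepFun_process (fun t => h.measurable _)
    (fun t => (h.laterIncrement s).measurable t) fun I J => ?_
  -- One time grid contains s and all times involved. Stopped values are sums of grid increments
  -- before index `K`, later increments are sums of those from `K` on, and these two blocks are
  -- independent.
  obtain ⟨t, ht, ht0, htc⟩ := exists_monotone_nat_cover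
    (insert s (I.image (fun r => min r s) ∪ J.image fun r => s + r))
  obtain ⟨K, hK⟩ := htc s (by simp)
  have hI : ∀ i : I, ∃ k ≤ K, t k = min i.1 s := fun i => by
    obtain ⟨k, hk⟩ := htc (min i.1 s)
      (Finset.mem_insert_of_mem (Finset.mem_union_left _ (Finset.mem_image_of_mem _ i.2)))
    by_cases hkK : k ≤ K
    · exact ⟨k, hkK, hk⟩
    -- The grid may repeat times: an index on the wrong side of `K` can only name the time s itself,
    -- so `K` serves instead.
    · refine ⟨K, le_rfl, le_antisymm ?_ ?_⟩
      · rw [← hk]; exact ht (by omega)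
      · rw [hK]; exact min_le_right _ _
  have hJ : ∀ j : J, ∃ k, K ≤ k ∧ t k = s + j.1 := fun j => by
    obtain ⟨k, hk⟩ := htc (s + j.1)
      (Finset.mem_insert_of_mem (Finset.mem_union_right _ (Finset.mem_image_of_mem _ j.2)))
    by_cases hkK : K ≤ k
    · exact ⟨k, hkK, hk⟩
    · refine ⟨K, le_rfl, le_antisymm ?_ ?_⟩
      · rw [hK]; exact le_self_add
      · rw [← hk]; exact ht (by omega)
  choose a haK ha using hI
  choose b hbK hb using hJ
  set N := K + ∑ j, b j with hN
  have hbN : ∀ j, b j ≤ N := fun j =>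
    (Finset.single_le_sum (f := b) (fun _ _ => Nat.zero_le _) (Finset.mem_univ j)).trans
      (Nat.le_add_left _ _)
  have hind := (h.indep_increments.nat ht).indepFun_finset (Finset.range K) (Finset.Ico K N)
    (by
      rw [Finset.disjoint_left]
      intro i hi hi'
      simp at hi hi'
      omega)
    (fun i => (h.measurable _).sub (h.measurable _))
  let φ : (Finset.range K → ℝ) → I → ℝ := fun d i =>
    ∑ k : Finset.range K, if k.1 < a i then d k else 0
  let ψ : (Finset.Ico K N → ℝ) → J → ℝ := fun d j =>
    ∑ k : Finset.Ico K N, if k.1 < b j then d k else 0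
  have hφ : Measurable φ := measurable_pi_lambda _ fun i =>
    Finset.measurable_sum _ fun k _ => by
      split_ifs
      · exact measurable_pi_apply k
      · exact measurable_const
  have hψ : Measurable ψ := measurable_pi_lambda _ fun i =>
    Finset.measurable_sum _ fun k _ => by
      split_ifs
      · exact measurable_pi_apply k
      · exact measurable_const
  convert hind.comp hφ hψ using 1
  · ext ω i
    simp only [φ, Function.comp]
    rw [Finset.sum_coe_sort (Finset.range K)
      (fun k => if k < a i then ξ (t (k + 1)) ω - ξ (t k) ω else 0), ← Finset.sum_filter,
      show (Finset.range K).filter (· < a i) = Finset.range (a i) by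
        ext k; have := haK i; simp; omega,
      sum_range_increments, ht0, h.zero, ha, sub_zero]
  · ext ω j
    simp only [ψ, Function.comp]
    rw [Finset.sum_coe_sort (Finset.Ico K N)
      (fun k => if k < b j then ξ (t (k + 1)) ω - ξ (t k) ω else 0), ← Finset.sum_filter,
      show (Finset.Ico K N).filter (· < b j) = Finset.Ico K (b j) by
        ext k; have := hbN j; simp; omega,
      Finset.sum_Ico_eq_sub _ (hbK j), sum_range_increments, sum_range_increments, hK, hb,
      _root_.laterIncrement]
    ring

/-- Regular Lévy processes with the same one-dimensional laws have the same law. -/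
lemma map_eq_of_forall_map_eq [IsProbabilityMeasure P] {η : ℝ≥0 → Ω → ℝ} (h : IsRegularLevy ξ P)
    (h' : IsRegularLevy η P) (heq : ∀ t, P.map (ξ t) = P.map (η t)) :
    P.map (fun ω t => ξ t ω) = P.map (fun ω t => η t ω) := by
  classical
  rw [map_eq_iff_forall_finset_map_restrict_eq
    (measurable_pi_lambda _ h.measurable).aemeasurable
    (measurable_pi_lambda _ h'.measurable).aemeasurable]
  intro I
  obtain ⟨t, ht, ht0, htc⟩ := exists_monotone_nat_cover I
  have hI : ∀ i : I, ∃ k, t k = i.1 := fun i => htc i.1 i.2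
  choose a ha using hI
  set N := ∑ j, a j with hN
  have haN : ∀ j, a j ≤ N := fun j =>
    Finset.single_le_sum (f := a) (fun _ _ => Nat.zero_le _) (Finset.mem_univ j)
  let φ : (Fin N → ℝ) → I → ℝ := fun d i => ∑ k : Fin N, if k.1 < a i then d k else 0
  have hφ : Measurable φ := measurable_pi_lambda _ fun i =>
    Finset.measurable_sum _ fun k _ => by
      split_ifs
      · exact measurable_pi_apply k
      · exact measurable_const
  -- Finite-dimensional laws are images, under one fixed summation map, of products of increment
  -- laws; by stationarity these are one-dimensional laws of the process.
  have key : ∀ ζ : ℝ≥0 → Ω → ℝ, IsRegularLevy ζ P →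
      P.map (fun ω => I.restrict fun r => ζ r ω) =
        (Measure.pi fun k : Fin N => P.map (ζ (t (k + 1) - t k))).map φ := by
    intro ζ hζ
    have hm : ∀ k : Fin N, Measurable fun ω => ζ (t (k + 1)) ω - ζ (t k) ω :=
      fun k => (hζ.measurable _).sub (hζ.measurable _)
    have hind := (hζ.indep_increments.nat ht).precomp (g := fun k : Fin N => (k : ℕ))
      Fin.val_injective
    have := (iIndepFun_iff_map_fun_eq_pi_map (fun k => (hm k).aemeasurable)).1 hind
    simp only [hζ.map_increment (ht (Nat.le_succ _))] at this
    rw [← this, Measure.map_map hφ (measurable_pi_lambda _ hm)]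
    congr 1
    ext ω i
    simp only [φ, Function.comp, Finset.restrict]
    rw [Fin.sum_univ_eq_sum_range (fun k => if k < a i then ζ (t (k + 1)) ω - ζ (t k) ω else 0),
      ← Finset.sum_filter,
      show (Finset.range N).filter (· < a i) = Finset.range (a i) by
        ext k; have := haN i; simp; omega,
      sum_range_increments, ht0, hζ.zero, ha, sub_zero]
  rw [key ξ h, key η h']
  simp only [heq]

lemma map_laterIncrement [IsProbabilityMeasure P] (h : IsRegularLevy ξ P) (s : ℝ≥0) :
    P.map (fun ω t => _root_.laterIncrement ξ s t ω) = P.map (fun ω t => ξ t ω) :=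
  (h.laterIncrement s).map_eq_of_forall_map_eq h fun t => h.stationary_increments s t

/-- The simple Markov property. -/
lemma lintegral_stopped_laterIncrement [IsProbabilityMeasure P] (h : IsRegularLevy ξ P) (s : ℝ≥0)
    {F : (ℝ≥0 → ℝ) → (ℝ≥0 → ℝ) → ℝ≥0∞} (hF : Measurable (Function.uncurry F)) :
    ∫⁻ ω, F (fun t => ξ (min t s) ω) (fun t => _root_.laterIncrement ξ s t ω) ∂P =
      ∫⁻ ω, ∫⁻ ω', F (fun t => ξ (min t s) ω) (fun t => ξ t ω') ∂P ∂P := by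
  have m1 : Measurable fun ω (t : ℝ≥0) => ξ (min t s) ω :=
    measurable_pi_lambda _ fun t => h.measurable _
  have m2 : Measurable fun ω (t : ℝ≥0) => _root_.laterIncrement ξ s t ω :=
    measurable_pi_lambda _ (h.laterIncrement s).measurable
  have m3 : Measurable fun ω (t : ℝ≥0) => ξ t ω := measurable_pi_lambda _ h.measurable
  -- Independence turns the joint law into a product, stationarity replaces the law of the later
  -- increments by that of ξ, and Tonelli concludes.
  have e := (h.indepFun_laterIncrement s).map_prod_eq_prod_map_map m1.aemeasurable m2.aemeasurable
  rw [h.map_laterIncrement] at e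
  have hmap := lintegral_map hF (m1.prodMk m2) (μ := P)
  have : IsProbabilityMeasure (P.map fun ω (t : ℝ≥0) => ξ t ω) :=
    Measure.isProbabilityMeasure_map m3.aemeasurable
  rw [e, lintegral_prod _ hF.aemeasurable,
    lintegral_map (by exact hF.lintegral_prod_right') m1] at hmap
  simp only [Function.uncurry_apply_pair] at hmap
  rw [← hmap]
  refine lintegral_congr fun ω => ?_
  rw [lintegral_map (by exact hF.comp measurable_prodMk_left) m3]

end IsRegularLevy

end Markov

/-! ### A maximal inequality -/

section Maximal

variable {Ω : Type*} [MeasurableSpace Ω] {P : Measure Ω}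

/-- A maximal inequality: if each bad event makes `C` likely given the past, then the probability
that some bad event happens is controlled by that of `C`. -/
lemma mul_measure_biUnion_finset_le {ι : Type*} [LinearOrder ι] (𝓕 : ι → MeasurableSpace Ω)
    (hle : ∀ i, 𝓕 i ≤ ‹MeasurableSpace Ω›) (hmono : Monotone 𝓕) {bad : ι → Set Ω}
    (hbad : ∀ i, MeasurableSet[𝓕 i] (bad i)) {C : Set Ω} (hC : MeasurableSet C) {α : ℝ≥0∞}
    (F : Finset ι)
    (h : ∀ i ∈ F, ∀ B, MeasurableSet[𝓕 i] B → B ⊆ bad i → α * P B ≤ P (B ∩ C)) :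
    α * P (⋃ i ∈ F, bad i) ≤ P ((⋃ i ∈ F, bad i) ∩ C) := by
  classical
  induction F using Finset.induction_on_max with
  | empty => simp
  | insert a s hs ih =>
    have ih := ih fun i hi => h i (Finset.mem_insert_of_mem hi)
    -- Decomposition by the first bad time: `bad a \ G` is where the largest index a is the first
    -- bad one, and it belongs to the past of a.
    set G := ⋃ i ∈ s, bad i with hG
    have hGm : MeasurableSet[𝓕 a] G :=
      MeasurableSet.biUnion s.countable_toSet fun i hi => hmono (hs i hi).le _ (hbad i)
    have hBm : MeasurableSet[𝓕 a] (bad a \ G) := (hbad a).diff hGm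
    have hB := h a (Finset.mem_insert_self _ _) (bad a \ G) hBm Set.sdiff_subset
    have e : ⋃ i ∈ insert a s, bad i = G ∪ (bad a \ G) := by
      rw [Finset.set_biUnion_insert, Set.union_sdiff_self, Set.union_comm]
    have hd : Disjoint G (bad a \ G) := Set.disjoint_sdiff_right
    rw [e, measure_union hd (hle a _ hBm), Set.union_inter_distrib_right,
      measure_union (hd.mono Set.inter_subset_left Set.inter_subset_left)
        ((hle a _ hBm).inter hC), mul_add]
    exact add_le_add ih hB

/-- The sequence need not be increasing: its finite initial pieces are treated as sets of times,
ordered by the finite version, and continuity from below gives the union. This is what permits a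
dense sequence of times. -/
lemma mul_measure_iUnion_le {ι : Type*} [LinearOrder ι] (𝓕 : ι → MeasurableSpace Ω)
    (hle : ∀ i, 𝓕 i ≤ ‹MeasurableSpace Ω›) (hmono : Monotone 𝓕) {bad : ι → Set Ω}
    (hbad : ∀ i, MeasurableSet[𝓕 i] (bad i)) {C : Set Ω} (hC : MeasurableSet C) {α : ℝ≥0∞}
    (t : ℕ → ι)
    (h : ∀ n, ∀ B, MeasurableSet[𝓕 (t n)] B → B ⊆ bad (t n) → α * P B ≤ P (B ∩ C)) :
    α * P (⋃ n, bad (t n)) ≤ P C := by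
  classical
  have e : ⋃ n, bad (t n) = ⋃ N : ℕ, ⋃ i ∈ (Finset.range N).image t, bad i := by
    ext ω
    simp only [Set.mem_iUnion, Finset.mem_image, Finset.mem_range]
    constructor
    · rintro ⟨n, hn⟩
      exact ⟨n + 1, t n, ⟨n, by omega, rfl⟩, hn⟩
    · rintro ⟨N, _, ⟨n, _, rfl⟩, hn⟩
      exact ⟨n, hn⟩
  have hm : Monotone fun N : ℕ => ⋃ i ∈ (Finset.range N).image t, bad i := by
    intro N M hNM
    exact Set.biUnion_subset_biUnion_left fun i hi => by
      simp only [Finset.coe_image, Set.mem_image, Finset.mem_range, SetLike.mem_coe] at hi ⊢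
      obtain ⟨n, hn, rfl⟩ := hi
      exact ⟨n, by omega, rfl⟩
  rw [e, hm.measure_iUnion, ENNReal.mul_iSup]
  refine iSup_le fun N => ?_
  refine (mul_measure_biUnion_finset_le 𝓕 hle hmono hbad hC _ fun i hi => ?_).trans
    (measure_mono Set.inter_subset_right)
  obtain ⟨n, _, rfl⟩ := Finset.mem_image.1 hi
  exact h n

end Maximal

/-! ### Past σ-algebras and visits to open sets along dense times -/

/-- The σ-algebra generated by the process up to time `s`. -/
@[reducible]
def pastSigma {Ω : Type*} (ξ : ℝ≥0 → Ω → ℝ) (s : ℝ≥0) : MeasurableSpace Ω :=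
  MeasurableSpace.comap (fun ω t => ξ (min t s) ω) inferInstance

lemma measurable_pastSigma {Ω : Type*} (ξ : ℝ≥0 → Ω → ℝ) {s t : ℝ≥0} (hst : s ≤ t) :
    Measurable[pastSigma ξ t] (ξ s) := by
  have : ξ s = (fun w : ℝ≥0 → ℝ => w s) ∘ fun ω r => ξ (min r t) ω := by
    ext ω; simp [hst]
  rw [this]
  exact (measurable_pi_apply s).comp (comap_measurable _)

lemma monotone_pastSigma {Ω : Type*} (ξ : ℝ≥0 → Ω → ℝ) : Monotone (pastSigma ξ) := by
  intro s t hst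
  refine Measurable.comap_le ?_
  exact @measurable_pi_lambda _ _ _ (pastSigma ξ t) _ _ fun r =>
    measurable_pastSigma ξ ((min_le_right _ _).trans hst)

namespace IsRegularLevy

variable {Ω : Type*} [MeasurableSpace Ω] {P : Measure Ω} {ξ : ℝ≥0 → Ω → ℝ}

lemma pastSigma_le (h : IsRegularLevy ξ P) (s : ℝ≥0) : pastSigma ξ s ≤ ‹MeasurableSpace Ω› :=
  (measurable_pi_lambda _ fun _ => h.measurable _).comap_le

/-- The Markov property for an event of the past and an event depending on the present position
and on the increments to come. -/
lemma measure_inter_laterIncrement [IsProbabilityMeasure P] (h : IsRegularLevy ξ P) {s : ℝ≥0}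
    {B : Set Ω} (hB : MeasurableSet[pastSigma ξ s] B) {D : Set (ℝ × (ℝ≥0 → ℝ))}
    (hD : MeasurableSet D) :
    P (B ∩ {ω | (ξ s ω, fun t => _root_.laterIncrement ξ s t ω) ∈ D}) =
      ∫⁻ ω in B, P {ω' | (ξ s ω, fun t => ξ t ω') ∈ D} ∂P := by
  have hBm := h.pastSigma_le s _ hB
  obtain ⟨S, hS, rfl⟩ := hB
  have hF : Measurable (Function.uncurry fun w w' : ℝ≥0 → ℝ =>
      S.indicator (fun _ => D.indicator (fun _ => (1 : ℝ≥0∞)) (w s, w')) w) := by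
    have e : (Function.uncurry fun w w' : ℝ≥0 → ℝ =>
        S.indicator (fun _ => D.indicator (fun _ => (1 : ℝ≥0∞)) (w s, w')) w) =
        ((Prod.fst ⁻¹' S) ∩ (fun p : (ℝ≥0 → ℝ) × (ℝ≥0 → ℝ) => (p.1 s, p.2)) ⁻¹' D).indicator 1 := by
      ext ⟨w, w'⟩
      by_cases h1 : w ∈ S <;> by_cases h2 : (w s, w') ∈ D <;> simp [h1, h2]
    rw [e]
    refine measurable_one.indicator ((measurable_fst hS).inter ?_)
    exact (((measurable_pi_apply s).comp measurable_fst).prodMk measurable_snd) hD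
  have m1 : Measurable fun ω => (ξ s ω, fun t => _root_.laterIncrement ξ s t ω) :=
    (h.measurable s).prodMk (measurable_pi_lambda _ (h.laterIncrement s).measurable)
  have m3 : Measurable fun ω (t : ℝ≥0) => ξ t ω := measurable_pi_lambda _ h.measurable
  have key := h.lintegral_stopped_laterIncrement s hF
  have e := lintegral_indicator_one (μ := P) (hBm.inter (m1 hD))
  refine e.symm.trans ?_
  rw [← lintegral_indicator hBm]
  simp only [min_self] at key
  convert key using 1
  · refine lintegral_congr fun ω => ?_
    simp only [Set.indicator, Set.mem_inter_iff, Set.mem_preimage, Pi.one_apply]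
    split_ifs <;> simp_all
  · refine lintegral_congr fun ω => ?_
    by_cases hω : (fun t => ξ (min t s) ω) ∈ S
    · rw [Set.indicator_of_mem (by exact hω)]
      simp only [Set.indicator_of_mem hω]
      exact (lintegral_indicator_one ((measurable_prodMk_left.comp m3) hD)).symm
    · rw [Set.indicator_of_notMem (by exact hω)]
      simp [Set.indicator_of_notMem hω]

lemma continuousWithinAt_dense (h : IsRegularLevy ξ P) (ω : Ω) (s : ℝ≥0) {O : Set ℝ}
    (hO : IsOpen O) (hs : ξ s ω ∈ O) {b : ℝ≥0} (hsb : s < b) :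
    ∃ r, s < r ∧ r < b ∧ ∀ q, s ≤ q → q < r → ξ q ω ∈ O := by
  have := h.continuousWithinAt ω s (hO.mem_nhds hs)
  obtain ⟨r, hr, hsub⟩ := (mem_nhdsGE_iff_exists_Ico_subset' hsb).1 this
  obtain ⟨r', h1, h2⟩ := exists_between (lt_min hr hsb)
  exact ⟨r', h1, h2.trans_le (min_le_right _ _),
    fun q hq hq' => hsub ⟨hq, hq'.trans (h2.trans_le (min_le_left _ _))⟩⟩

/-- If a path meets an open set at or after time `s`, it does so at a time `s + q` with `q` in a
dense sequence. -/
lemma exists_denseSeq_mem (h : IsRegularLevy ξ P) (ω : Ω) {m s b : ℝ≥0} (hms : m ≤ s) (hsb : s < b)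
    {O : Set ℝ} (hO : IsOpen O) (hs : ξ s ω ∈ O) :
    ∃ n, m + TopologicalSpace.denseSeq ℝ≥0 n < b ∧ ξ (m + TopologicalSpace.denseSeq ℝ≥0 n) ω ∈ O := by
  obtain ⟨r, hr, hrb, H⟩ := h.continuousWithinAt_dense ω s hO hs hsb
  have hlt : s - m < r - m := (tsub_lt_tsub_iff_right hms).2 hr
  obtain ⟨n, hq⟩ := (TopologicalSpace.denseRange_denseSeq ℝ≥0).exists_mem_open
    (isOpen_Ioo (a := s - m) (b := r - m)) (Set.nonempty_Ioo.2 hlt)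
  have h1 : s ≤ m + TopologicalSpace.denseSeq ℝ≥0 n := by
    have := hq.1.le; rwa [tsub_le_iff_left] at this
  have h2 : m + TopologicalSpace.denseSeq ℝ≥0 n < r := by
    have := hq.2; rwa [lt_tsub_iff_left] at this
  exact ⟨n, h2.trans hrb, H _ h1 h2⟩

end IsRegularLevy

/-! ### Boundedness of paths on bounded time intervals -/

namespace IsRegularLevy

variable {Ω : Type*} [MeasurableSpace Ω] {P : Measure Ω} {ξ : ℝ≥0 → Ω → ℝ}

lemma measure_laterIncrement_mem (h : IsRegularLevy ξ P) (s t : ℝ≥0) {A : Set ℝ}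
    (hA : MeasurableSet A) : P (_root_.laterIncrement ξ s t ⁻¹' A) = P (ξ t ⁻¹' A) := by
  rw [← Measure.map_apply ((h.laterIncrement s).measurable t) hA,
    ← Measure.map_apply (h.measurable t) hA]
  exact congrArg (fun ν : Measure ℝ => ν A) (h.stationary_increments s t)

/-- Stochastic continuity at time `0`. -/
lemma exists_pos_forall_le_measure [IsProbabilityMeasure P] (h : IsRegularLevy ξ P) :
    ∃ t₀ : ℝ≥0, 0 < t₀ ∧ ∀ r ≤ t₀, 2⁻¹ ≤ P (ξ r ⁻¹' Set.Icc (-1) 1) := by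
  have hS : MeasurableSet (Set.Icc (-1 : ℝ) 1) := measurableSet_Icc
  have key : Tendsto (fun r => ∫⁻ ω, (Set.Icc (-1 : ℝ) 1).indicator 1 (ξ r ω) ∂P)
      (𝓝[Set.Ici 0] 0) (𝓝 (∫⁻ _, (1 : ℝ≥0∞) ∂P)) := by
    refine tendsto_lintegral_filter_of_dominated_convergence (fun _ => (1 : ℝ≥0∞))
      (Eventually.of_forall fun r => (measurable_one.indicator hS).comp (h.measurable r))
      (Eventually.of_forall fun r => Eventually.of_forall fun ω => ?_) (by simp)
      (Eventually.of_forall fun ω => ?_)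
    · exact Set.indicator_le (fun _ _ => le_rfl) _ |>.trans (by simp)
    · have hc := h.continuousWithinAt ω 0
      rw [ContinuousWithinAt, h.zero] at hc
      refine tendsto_const_nhds.congr' ?_
      filter_upwards [hc (Icc_mem_nhds (by norm_num : (-1 : ℝ) < 0) one_pos)] with r hr
      rw [Set.indicator_of_mem (by exact hr)]
      rfl
  have hIci : Set.Ici (0 : ℝ≥0) = Set.univ := by ext; simp
  rw [hIci, nhdsWithin_univ, lintegral_const, measure_univ, one_mul] at key
  have hev := key.eventually (lt_mem_nhds (show (2⁻¹ : ℝ≥0∞) < 1 by simp))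
  obtain ⟨ε, hε, hsub⟩ := Metric.eventually_nhds_iff.1 hev
  refine ⟨(ε / 2).toNNReal, Real.toNNReal_pos.2 (by positivity), fun r hr => ?_⟩
  have hr' : dist r 0 < ε := by
    rw [NNReal.dist_eq]
    have : (r : ℝ) ≤ ε / 2 := by
      have := NNReal.coe_le_coe.2 hr
      rwa [Real.coe_toNNReal _ (by positivity)] at this
    simp only [NNReal.coe_zero, sub_zero, NNReal.abs_eq]
    linarith
  have := (hsub hr').le
  rwa [← lintegral_indicator_one (h.measurable r hS)]

/-- Right-continuity alone allows blow-up from the left, so an Ottaviani-type argument is needed. If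
`|ξ_s| > a + 1`, then with conditional probability at least 1/2 the increment up to `t₀` is at most
1 in size, whence `|ξ_{t₀}| > a`. So the probability of exceeding `a + 1` before `t₀` is at most `2
P(|ξ_{t₀}| > a)`, which tends to 0. -/
lemma ae_exists_bound_of_lt [IsProbabilityMeasure P] (h : IsRegularLevy ξ P) {t₀ : ℝ≥0}
    (ht : ∀ r ≤ t₀, 2⁻¹ ≤ P (ξ r ⁻¹' Set.Icc (-1) 1)) :
    ∀ᵐ ω ∂P, ∃ a : ℝ, ∀ s < t₀, |ξ s ω| ≤ a := by
  have hO : ∀ a : ℝ, IsOpen {y : ℝ | a < |y|} := fun a =>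
    isOpen_lt continuous_const continuous_abs
  have hmax : ∀ a : ℝ, 2⁻¹ * P {ω | ∃ s < t₀, a + 1 < |ξ s ω|} ≤ P (ξ t₀ ⁻¹' {y | a < |y|}) := by
    intro a
    -- Dense times are capped at `t₀` so that an increment from each of them to `t₀` exists;
    -- excursions before `t₀` are already seen at uncapped ones.
    refine le_trans (mul_le_mul_right (measure_mono ?_) _) (mul_measure_iUnion_le (pastSigma ξ)
      h.pastSigma_le (monotone_pastSigma ξ) (bad := fun s => ξ s ⁻¹' {y | a + 1 < |y|})
      (fun s => measurable_pastSigma ξ le_rfl (hO _).measurableSet)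
      (h.measurable t₀ (hO a).measurableSet) (α := 2⁻¹)
      (fun n => min (TopologicalSpace.denseSeq ℝ≥0 n) t₀) fun n B hB hsub => ?_)
    · rintro ω ⟨s, hs, hsa⟩
      obtain ⟨n, hn, hm⟩ := h.exists_denseSeq_mem ω (m := 0) zero_le hs (hO (a + 1)) hsa
      rw [zero_add] at hn hm
      refine Set.mem_iUnion.2 ⟨n, ?_⟩
      rw [min_eq_left hn.le]
      exact hm
    · set s := min (TopologicalSpace.denseSeq ℝ≥0 n) t₀ with hs
      have hst : s ≤ t₀ := min_le_right _ _
      have hD : MeasurableSet {p : ℝ × (ℝ≥0 → ℝ) | p.2 (t₀ - s) ∈ Set.Icc (-1 : ℝ) 1} :=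
        ((measurable_pi_apply (t₀ - s)).comp measurable_snd) measurableSet_Icc
      have e := h.measure_inter_laterIncrement hB hD
      calc 2⁻¹ * P B = ∫⁻ _ in B, 2⁻¹ ∂P := by rw [setLIntegral_const]
        _ ≤ ∫⁻ ω in B, P {ω' | (ξ s ω, fun t => ξ t ω') ∈
            {p : ℝ × (ℝ≥0 → ℝ) | p.2 (t₀ - s) ∈ Set.Icc (-1 : ℝ) 1}} ∂P :=
          lintegral_mono fun ω => ht _ tsub_le_self
        _ ≤ P (B ∩ ξ t₀ ⁻¹' {y | a < |y|}) := by
          rw [← e]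
          refine measure_mono fun ω hω => ⟨hω.1, ?_⟩
          have h1 : a + 1 < |ξ s ω| := hsub hω.1
          have h2 : _root_.laterIncrement ξ s (t₀ - s) ω ∈ Set.Icc (-1 : ℝ) 1 := hω.2
          rw [_root_.laterIncrement, add_tsub_cancel_of_le hst] at h2
          change a < |ξ t₀ ω|
          have h3 := abs_sub_abs_le_abs_sub (ξ s ω) (ξ t₀ ω)
          have h4 : |ξ s ω - ξ t₀ ω| ≤ 1 := by
            rw [abs_sub_comm]; exact abs_le.2 h2
          linarith
  have hlim : Tendsto (fun a : ℕ => P (ξ t₀ ⁻¹' {y | (a : ℝ) < |y|})) atTop (𝓝 0) := by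
    have := tendsto_measure_iInter_atTop (μ := P)
      (s := fun a : ℕ => ξ t₀ ⁻¹' {y | (a : ℝ) < |y|})
      (fun a => (h.measurable t₀ (hO _).measurableSet).nullMeasurableSet)
      (fun a b hab ω (hω : (b : ℝ) < |ξ t₀ ω|) =>
        show (a : ℝ) < |ξ t₀ ω| from lt_of_le_of_lt (Nat.cast_le.2 hab) hω) ⟨0, measure_ne_top _ _⟩
    have he : ⋂ a : ℕ, ξ t₀ ⁻¹' {y | (a : ℝ) < |y|} = ∅ := by
      refine Set.eq_empty_of_forall_notMem fun ω hω => ?_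
      obtain ⟨n, hn⟩ := exists_nat_ge |ξ t₀ ω|
      exact absurd (Set.mem_iInter.1 hω n) (not_lt.2 hn)
    rwa [he, measure_empty] at this
  have hzero : 2⁻¹ * P {ω | ¬ ∃ a : ℝ, ∀ s < t₀, |ξ s ω| ≤ a} ≤ 0 := by
    refine ge_of_tendsto' hlim fun a => le_trans (mul_le_mul_right (measure_mono ?_) _) (hmax a)
    intro ω hω
    by_contra hcon
    refine hω ⟨a + 1, fun s hs => ?_⟩
    by_contra hlt
    exact hcon ⟨s, hs, not_le.1 hlt⟩
  have := nonpos_iff_eq_zero.1 hzero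
  rw [mul_eq_zero] at this
  exact this.resolve_left (by simp)

/-- Almost surely, the paths of a Lévy process are bounded on bounded time intervals. -/
lemma ae_locally_bounded [IsProbabilityMeasure P] (h : IsRegularLevy ξ P) :
    ∀ᵐ ω ∂P, ∀ T : ℝ≥0, ∃ C : ℝ, ∀ s ≤ T, |ξ s ω| ≤ C := by
  obtain ⟨t₀, ht₀, ht⟩ := h.exists_pos_forall_le_measure
  -- Time is cut into blocks of length `t₀`; by stationarity each block satisfies the same estimate
  -- as the first.
  have hk : ∀ k : ℕ, ∀ᵐ ω ∂P, ∃ a : ℝ, ∀ s < t₀, |_root_.laterIncrement ξ (k * t₀) s ω| ≤ a := by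
    intro k
    refine (h.laterIncrement (k * t₀)).ae_exists_bound_of_lt fun r hr => ?_
    rw [h.measure_laterIncrement_mem _ _ measurableSet_Icc]
    exact ht r hr
  filter_upwards [ae_all_iff.2 hk] with ω hω T
  choose a ha using hω
  have hterm : ∀ k, 0 ≤ |a k| + |ξ (k * t₀) ω| := fun k => by positivity
  refine ⟨∑ k ∈ Finset.range (⌊T / t₀⌋₊ + 1), (|a k| + |ξ (k * t₀) ω|), fun s hs => ?_⟩
  set k := ⌊s / t₀⌋₊ with hkdef
  have hk1 : (k : ℝ≥0) * t₀ ≤ s := by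
    rw [← le_div_iff₀ ht₀]; exact Nat.floor_le zero_le
  have hk2 : s < k * t₀ + t₀ := by
    have := Nat.lt_floor_add_one (s / t₀)
    rw [div_lt_iff₀ ht₀, add_mul, one_mul] at this
    exact this
  have hkT : k ≤ ⌊T / t₀⌋₊ := Nat.floor_mono (by gcongr)
  have h1 := ha k (s - k * t₀) ((tsub_lt_iff_left hk1).2 hk2)
  rw [_root_.laterIncrement, add_tsub_cancel_of_le hk1] at h1
  calc |ξ s ω| = |(ξ s ω - ξ (k * t₀) ω) + ξ (k * t₀) ω| := by ring_nf
    _ ≤ |ξ s ω - ξ (k * t₀) ω| + |ξ (k * t₀) ω| := abs_add_le _ _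
    _ ≤ |a k| + |ξ (k * t₀) ω| := add_le_add_left (h1.trans (le_abs_self _)) _
    _ ≤ _ := Finset.single_le_sum (f := fun k : ℕ => |a k| + |ξ (k * t₀) ω|)
      (fun k _ => hterm k) (Finset.mem_range.2 (by omega))

end IsRegularLevy

/-! ### Measurable functionals of the path -/

/-- The `n`-th grid point following `t`. -/
noncomputable def timeGrid (n : ℕ) (t : ℝ≥0) : ℝ≥0 :=
  ((⌊((n : ℝ≥0) + 1) * t⌋₊ : ℝ≥0) + 1) / ((n : ℝ≥0) + 1)

lemma tendsto_timeGrid (t : ℝ≥0) : Tendsto (fun n => timeGrid n t) atTop (𝓝[Set.Ici t] t) := by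
  have h1 : ∀ n, t ≤ timeGrid n t := fun n => by
    rw [timeGrid, le_div_iff₀ (by positivity), mul_comm]
    exact (Nat.lt_floor_add_one _).le
  have h2 : ∀ n, timeGrid n t ≤ t + 1 / ((n : ℝ≥0) + 1) := fun n => by
    have e : (t + 1 / ((n : ℝ≥0) + 1)) * ((n : ℝ≥0) + 1) = ((n : ℝ≥0) + 1) * t + 1 := by
      field_simp
    rw [timeGrid, div_le_iff₀ (by positivity), e]
    exact add_le_add_left (Nat.floor_le (by positivity)) 1
  refine tendsto_nhdsWithin_iff.2 ⟨?_, Eventually.of_forall h1⟩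
  refine tendsto_of_tendsto_of_tendsto_of_le_of_le tendsto_const_nhds ?_ h1 h2
  simpa using (tendsto_const_nhds (x := t)).add
    (tendsto_one_div_add_atTop_nhds_zero_nat (𝕜 := ℝ≥0))

/-- The evaluation of a right-continuous path, as a jointly measurable functional. -/
noncomputable def pathEval (w : ℝ≥0 → ℝ) (t : ℝ≥0) : ℝ :=
  limsup (fun n => w (timeGrid n t)) atTop

lemma pathEval_eq {w : ℝ≥0 → ℝ} {t : ℝ≥0} (h : ContinuousWithinAt w (Set.Ici t) t) :
    pathEval w t = w t :=
  (h.tendsto.comp (tendsto_timeGrid t)).limsup_eq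

/-- At stage n only countably many evaluation times occur, selected by a measurable integer-valued
function of t. Plain evaluation `(w, t) ↦ w t` is not jointly measurable for the product σ-algebra.
-/
lemma measurable_pathEval : Measurable fun p : (ℝ≥0 → ℝ) × ℝ≥0 => pathEval p.1 p.2 := by
  refine Measurable.limsup fun n => ?_
  have e : (fun p : (ℝ≥0 → ℝ) × ℝ≥0 => p.1 (timeGrid n p.2)) =
      (fun q : (ℝ≥0 → ℝ) × ℕ => q.1 (((q.2 : ℝ≥0) + 1) / ((n : ℝ≥0) + 1))) ∘
        fun p => (p.1, ⌊((n : ℝ≥0) + 1) * p.2⌋₊) := rfl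
  rw [e]
  refine Measurable.comp (measurable_from_prod_countable_left fun k => ?_)
    (measurable_fst.prodMk (Nat.measurable_floor.comp (by fun_prop)))
  exact measurable_pi_apply (((k : ℝ≥0) + 1) / ((n : ℝ≥0) + 1))

/-- The perpetual integral of a path started from `y`. -/
noncomputable def pathIntegral (f : ℝ → ℝ≥0) (y : ℝ) (w : ℝ≥0 → ℝ) : ℝ≥0∞ :=
  ∫⁻ s in Set.Ici (0 : ℝ), (f (y + pathEval w s.toNNReal) : ℝ≥0∞)

lemma measurable_pathIntegral {f : ℝ → ℝ≥0} (hf : Measurable f) :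
    Measurable fun p : ℝ × (ℝ≥0 → ℝ) => pathIntegral f p.1 p.2 := by
  refine Measurable.lintegral_prod_right'
    (f := fun q : (ℝ × (ℝ≥0 → ℝ)) × ℝ => (f (q.1.1 + pathEval q.1.2 q.2.toNNReal) : ℝ≥0∞)) ?_
  have h1 : Measurable fun q : (ℝ × (ℝ≥0 → ℝ)) × ℝ => (q.1.2, q.2.toNNReal) :=
    (measurable_snd.comp measurable_fst).prodMk (measurable_real_toNNReal.comp measurable_snd)
  have h2 : Measurable fun q : (ℝ × (ℝ≥0 → ℝ)) × ℝ => q.1.1 :=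
    measurable_fst.comp measurable_fst
  exact (hf.comp (h2.add (measurable_pathEval.comp h1))).coe_nnreal_ennreal

lemma setLIntegral_Ici_eq (g : ℝ → ℝ≥0∞) (m : ℝ) :
    ∫⁻ s in Set.Ici m, g s = ∫⁻ s in Set.Ici 0, g (m + s) := by
  have := (measurePreserving_add_left volume m).setLIntegral_comp_preimage_emb
    (measurableEmbedding_addLeft m) g (Set.Ici m)
  rw [← this]
  congr 2
  ext s
  simp

/-- Monotone convergence along half-lines starting at `i + 1/(n+1)`. It carries a bound down to an
infimum that need not be attained. -/
lemma setLIntegral_Ioi_le_of_forall_Ici {g : ℝ → ℝ≥0∞} {i : ℝ} {K : ℝ≥0∞}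
    (h : ∀ s, i < s → ∫⁻ r in Set.Ici s, g r ≤ K) : ∫⁻ r in Set.Ioi i, g r ≤ K := by
  have e : Set.Ioi i = ⋃ n : ℕ, Set.Ici (i + 1 / ((n : ℝ) + 1)) := by
    ext s
    simp only [Set.mem_Ioi, Set.mem_iUnion, Set.mem_Ici]
    constructor
    · intro hs
      obtain ⟨n, hn⟩ := exists_nat_one_div_lt (sub_pos.2 hs)
      exact ⟨n, by linarith⟩
    · rintro ⟨n, hn⟩
      have : (0 : ℝ) < 1 / ((n : ℝ) + 1) := by positivity
      linarith
  have hm : Monotone fun n : ℕ => Set.Ici (i + 1 / ((n : ℝ) + 1)) := fun a b hab =>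
    Set.Ici_subset_Ici.2 (by gcongr)
  rw [e, setLIntegral_iUnion_of_directed _ hm.directed_le]
  refine iSup_le fun n => h _ ?_
  have : (0 : ℝ) < 1 / ((n : ℝ) + 1) := by positivity
  linarith

/-! ### Tail integrals and the potential bound -/

/-- The remaining integral after time `s`. -/
noncomputable def tailIntegral {Ω : Type*} (f : ℝ → ℝ≥0) (ξ : ℝ≥0 → Ω → ℝ) (x : ℝ) (s : ℝ≥0)
    (ω : Ω) : ℝ≥0∞ :=
  perpetualIntegral f (laterIncrement ξ s) (x + ξ s ω) ω

lemma tailIntegral_eq {Ω : Type*} (f : ℝ → ℝ≥0) (ξ : ℝ≥0 → Ω → ℝ) (x : ℝ) (s : ℝ≥0) (ω : Ω) :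
    tailIntegral f ξ x s ω = ∫⁻ r in Set.Ici (s : ℝ), (f (x + ξ r.toNNReal ω) : ℝ≥0∞) := by
  rw [setLIntegral_Ici_eq, tailIntegral, perpetualIntegral]
  refine setLIntegral_congr_fun measurableSet_Ici fun r hr => ?_
  simp only [laterIncrement]
  have e : ((s : ℝ) + r).toNNReal = s + r.toNNReal := by
    have := Real.toNNReal_add (NNReal.coe_nonneg s) hr
    rwa [Real.toNNReal_coe] at this
  simp only [e]
  congr 2
  ring

lemma tailIntegral_zero {Ω : Type*} (f : ℝ → ℝ≥0) (ξ : ℝ≥0 → Ω → ℝ) (x : ℝ) (ω : Ω) :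
    tailIntegral f ξ x 0 ω = perpetualIntegral f ξ x ω := by
  rw [tailIntegral_eq]; rfl

lemma tailIntegral_antitone {Ω : Type*} (f : ℝ → ℝ≥0) (ξ : ℝ≥0 → Ω → ℝ) (x : ℝ) (ω : Ω) :
    Antitone fun s => tailIntegral f ξ x s ω := by
  intro s t hst
  simp only [tailIntegral_eq]
  exact lintegral_mono_set (Set.Ici_subset_Ici.2 (NNReal.coe_le_coe.2 hst))

/-- The remaining integral decreases in time, so the times at which it is at most K form a final
interval. The integral of f over that interval is a limit of remaining integrals, each at most K. -/
lemma setLIntegral_tailIntegral_le {Ω : Type*} (f : ℝ → ℝ≥0) (ξ : ℝ≥0 → Ω → ℝ) (x : ℝ)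
    (K : ℝ≥0∞) (ω : Ω) :
    ∫⁻ s in Set.Ici (0 : ℝ), (Set.Iic K).indicator (fun _ => (f (x + ξ s.toNNReal ω) : ℝ≥0∞))
      (tailIntegral f ξ x s.toNNReal ω) ≤ K := by
  set A : Set ℝ := {s | 0 ≤ s ∧ tailIntegral f ξ x s.toNNReal ω ≤ K} with hA
  have hup : ∀ s ∈ A, ∀ r, s ≤ r → r ∈ A := fun s hs r hsr =>
    ⟨hs.1.trans hsr, (tailIntegral_antitone f ξ x ω (Real.toNNReal_le_toNNReal hsr)).trans hs.2⟩
  have hbdd : BddBelow A := ⟨0, fun s hs => hs.1⟩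
  have htail : ∀ s ∈ A, ∫⁻ r in Set.Ici s, (f (x + ξ r.toNNReal ω) : ℝ≥0∞) ≤ K := fun s hs => by
    have := hs.2
    rwa [tailIntegral_eq, Real.coe_toNNReal _ hs.1] at this
  have hAm : MeasurableSet A := (Set.OrdConnected.measurableSet
    ⟨fun a ha b _ c hc => hup a ha c hc.1⟩)
  have e : ∫⁻ s in Set.Ici (0 : ℝ),
      (Set.Iic K).indicator (fun _ => (f (x + ξ s.toNNReal ω) : ℝ≥0∞))
        (tailIntegral f ξ x s.toNNReal ω) = ∫⁻ s in A, (f (x + ξ s.toNNReal ω) : ℝ≥0∞) := by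
    rw [← lintegral_indicator measurableSet_Ici, ← lintegral_indicator hAm]
    refine lintegral_congr fun s => ?_
    by_cases h1 : 0 ≤ s <;> by_cases h2 : tailIntegral f ξ x s.toNNReal ω ≤ K <;>
      simp [hA, Set.indicator, h1, h2]
  rw [e]
  obtain hE | hne := A.eq_empty_or_nonempty
  · simp [hE]
  calc ∫⁻ s in A, (f (x + ξ s.toNNReal ω) : ℝ≥0∞)
      ≤ ∫⁻ s in Set.Ici (sInf A), (f (x + ξ s.toNNReal ω) : ℝ≥0∞) :=
        lintegral_mono_set fun s hs => csInf_le hbdd hs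
    _ = ∫⁻ s in Set.Ioi (sInf A), (f (x + ξ s.toNNReal ω) : ℝ≥0∞) :=
        setLIntegral_congr Ioi_ae_eq_Ici.symm
    _ ≤ K := by
        refine setLIntegral_Ioi_le_of_forall_Ici fun s hs => htail s ?_
        obtain ⟨r, hr, hrs⟩ := exists_lt_of_csInf_lt hne hs
        exact hup r hr s hrs.le

/-- The probability that the perpetual integral started from `y` lies in `S`. -/
noncomputable def perpetualProb {Ω : Type*} [MeasurableSpace Ω] (f : ℝ → ℝ≥0) (ξ : ℝ≥0 → Ω → ℝ)
    (P : Measure Ω) (S : Set ℝ≥0∞) (y : ℝ) : ℝ≥0∞ :=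
  P (perpetualIntegral f ξ y ⁻¹' S)

namespace IsRegularLevy

variable {Ω : Type*} [MeasurableSpace Ω] {P : Measure Ω} {ξ : ℝ≥0 → Ω → ℝ} {f : ℝ → ℝ≥0}

lemma measurable_uncurry (h : IsRegularLevy ξ P) : Measurable fun p : Ω × ℝ≥0 => ξ p.2 p.1 := by
  have e : (fun p : Ω × ℝ≥0 => ξ p.2 p.1) =
      (fun p : (ℝ≥0 → ℝ) × ℝ≥0 => pathEval p.1 p.2) ∘ fun p => ((fun t => ξ t p.1), p.2) := by
    ext p
    exact (pathEval_eq (h.continuousWithinAt p.1 p.2)).symm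
  rw [e]
  exact measurable_pathEval.comp
    (((measurable_pi_lambda _ h.measurable).comp measurable_fst).prodMk measurable_snd)

lemma perpetualIntegral_eq (h : IsRegularLevy ξ P) (f : ℝ → ℝ≥0) (y : ℝ) (ω : Ω) :
    perpetualIntegral f ξ y ω = pathIntegral f y fun t => ξ t ω := by
  refine lintegral_congr fun s => ?_
  rw [pathEval_eq (h.continuousWithinAt ω _)]

lemma measurable_perpetualIntegral (h : IsRegularLevy ξ P) (hf : Measurable f) :
    Measurable fun p : ℝ × Ω => perpetualIntegral f ξ p.1 p.2 := by
  simp only [h.perpetualIntegral_eq]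
  exact (measurable_pathIntegral hf).comp
    (measurable_fst.prodMk ((measurable_pi_lambda _ h.measurable).comp measurable_snd))

lemma measurable_perpetualProb [SFinite P] (h : IsRegularLevy ξ P) (hf : Measurable f)
    {S : Set ℝ≥0∞} (hS : MeasurableSet S) : Measurable (perpetualProb f ξ P S) :=
  measurable_measure_prodMk_left (h.measurable_perpetualIntegral hf hS)

lemma measurable_tailIntegral (h : IsRegularLevy ξ P) (hf : Measurable f) (x : ℝ) :
    Measurable fun p : Ω × ℝ≥0 => tailIntegral f ξ x p.2 p.1 := by
  simp only [tailIntegral, (h.laterIncrement _).perpetualIntegral_eq]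
  refine (measurable_pathIntegral hf).comp (Measurable.prodMk ?_ ?_)
  · exact measurable_const.add h.measurable_uncurry
  · refine measurable_pi_lambda _ fun t => ?_
    refine (h.measurable_uncurry.comp (f := fun p : Ω × ℝ≥0 => (p.1, p.2 + t)) ?_).sub
      h.measurable_uncurry
    exact measurable_fst.prodMk (by fun_prop)

/-- Given the past up to s, the remaining integral is distributed as a fresh perpetual integral
started from the present position. -/
lemma measure_inter_tailIntegral [IsProbabilityMeasure P] (h : IsRegularLevy ξ P)
    (hf : Measurable f) (x : ℝ) {s : ℝ≥0} {B : Set Ω} (hB : MeasurableSet[pastSigma ξ s] B)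
    {S : Set ℝ≥0∞} (hS : MeasurableSet S) :
    P (B ∩ tailIntegral f ξ x s ⁻¹' S) = ∫⁻ ω in B, perpetualProb f ξ P S (x + ξ s ω) ∂P := by
  have hD : MeasurableSet {p : ℝ × (ℝ≥0 → ℝ) | pathIntegral f (x + p.1) p.2 ∈ S} :=
    ((measurable_pathIntegral hf).comp
      ((measurable_const.add measurable_fst).prodMk measurable_snd)) hS
  have e := h.measure_inter_laterIncrement hB hD
  convert e using 2
  · congr 1
    ext ω
    simp [tailIntegral, (h.laterIncrement s).perpetualIntegral_eq]
  · ext ω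
    simp only [perpetualProb]
    congr 1
    ext ω'
    simp [h.perpetualIntegral_eq]

lemma lintegral_potentialMeasure [IsProbabilityMeasure P] (h : IsRegularLevy ξ P)
    {g : ℝ → ℝ≥0∞} (hg : Measurable g) :
    ∫⁻ y, g y ∂(potentialMeasure ξ P) =
      ∫⁻ s in Set.Ici (0 : ℝ), ∫⁻ ω, g (ξ s.toNNReal ω) ∂P := by
  have hm : Measurable fun s : ℝ => P.map (ξ s.toNNReal) :=
    (measurable_law h.toLevy).comp measurable_real_toNNReal
  rw [potentialMeasure, Measure.lintegral_bind hm.aemeasurable hg.aemeasurable]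
  exact lintegral_congr fun s => lintegral_map hg (h.measurable _)

lemma lintegral_potentialMeasure_swap [IsProbabilityMeasure P] (h : IsRegularLevy ξ P)
    {g : ℝ → ℝ≥0∞} (hg : Measurable g) :
    ∫⁻ y, g y ∂(potentialMeasure ξ P) =
      ∫⁻ ω, (∫⁻ s in Set.Ici (0 : ℝ), g (ξ s.toNNReal ω)) ∂P := by
  rw [h.lintegral_potentialMeasure hg]
  refine lintegral_lintegral_swap (f := fun (s : ℝ) ω => g (ξ s.toNNReal ω)) ?_
  refine (hg.comp (h.measurable_uncurry.comp
    (f := fun p : ℝ × Ω => (p.2, p.1.toNNReal)) ?_)).aemeasurable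
  exact measurable_snd.prodMk (measurable_real_toNNReal.comp measurable_fst)

/-- The potential of `f` restricted to a set on which the perpetual integral is at most `K` with
probability at least `c` is bounded by `K / c`. -/
lemma mul_setLIntegral_potentialMeasure_le [IsProbabilityMeasure P] (h : IsRegularLevy ξ P)
    (hf : Measurable f) (x : ℝ) {K c : ℝ≥0∞} (hctop : c ≠ ∞) {E : Set ℝ} (hE : MeasurableSet E)
    (hc : ∀ y ∈ E, c ≤ perpetualProb f ξ P (Set.Iic K) y) :
    c * ∫⁻ y in {y | x + y ∈ E}, (f (x + y) : ℝ≥0∞) ∂(potentialMeasure ξ P) ≤ K := by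
  have hE' : MeasurableSet {y | x + y ∈ E} := (measurable_const_add x) hE
  have hfx : Measurable fun y => (f (x + y) : ℝ≥0∞) :=
    (hf.comp (measurable_const_add x)).coe_nnreal_ennreal
  have hg := hfx.indicator hE'
  rw [← lintegral_indicator hE', h.lintegral_potentialMeasure hg, ← lintegral_const_mul' _ _ hctop]
  -- On `x + ξ_s ∈ E` the constant c is at most the conditional probability that the remaining
  -- integral is at most K; the Markov property replaces it by the indicator of that event.
  have step : ∀ s : ℝ≥0, c * ∫⁻ ω, {y | x + y ∈ E}.indicator (fun y => (f (x + y) : ℝ≥0∞))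
      (ξ s ω) ∂P ≤ ∫⁻ ω, (Set.Iic K).indicator (fun _ => (f (x + ξ s ω) : ℝ≥0∞))
        (tailIntegral f ξ x s ω) ∂P := by
    intro s
    have hF : Measurable (Function.uncurry fun w w' : ℝ≥0 → ℝ =>
        (f (x + w s) : ℝ≥0∞) * (Set.Iic K).indicator 1 (pathIntegral f (x + w s) w')) := by
      have h1 : Measurable fun p : (ℝ≥0 → ℝ) × (ℝ≥0 → ℝ) => x + p.1 s :=
        measurable_const.add ((measurable_pi_apply s).comp measurable_fst)
      refine (hf.comp h1).coe_nnreal_ennreal.mul ?_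
      exact (measurable_one.indicator measurableSet_Iic).comp
        ((measurable_pathIntegral hf).comp (h1.prodMk measurable_snd))
    have key := h.lintegral_stopped_laterIncrement s hF
    simp only [min_self] at key
    calc c * ∫⁻ ω, {y | x + y ∈ E}.indicator (fun y => (f (x + y) : ℝ≥0∞)) (ξ s ω) ∂P
        = ∫⁻ ω, c * {y | x + y ∈ E}.indicator (fun y => (f (x + y) : ℝ≥0∞)) (ξ s ω) ∂P :=
          (lintegral_const_mul' _ _ hctop).symm
      _ ≤ ∫⁻ ω, ∫⁻ ω', (f (x + ξ s ω) : ℝ≥0∞) *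
          (Set.Iic K).indicator 1 (pathIntegral f (x + ξ s ω) fun t => ξ t ω') ∂P ∂P := by
          refine lintegral_mono fun ω => ?_
          simp only
          rw [lintegral_const_mul' _ _ ENNReal.coe_ne_top]
          by_cases hω : x + ξ s ω ∈ E
          · rw [Set.indicator_of_mem (by exact hω), mul_comm]
            refine mul_le_mul_right ((hc _ hω).trans (le_of_eq ?_)) _
            refine (lintegral_indicator_one
              (((h.measurable_perpetualIntegral hf).comp measurable_prodMk_left)
                measurableSet_Iic)).symm.trans ?_
            refine lintegral_congr fun ω' => ?_
            rw [← h.perpetualIntegral_eq]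
            rfl
          · rw [Set.indicator_of_notMem (by exact hω), mul_zero]
            exact zero_le
      _ = ∫⁻ ω, (f (x + ξ s ω) : ℝ≥0∞) * (Set.Iic K).indicator 1
          (pathIntegral f (x + ξ s ω) fun t => _root_.laterIncrement ξ s t ω) ∂P := key.symm
      _ = _ := by
          refine lintegral_congr fun ω => ?_
          rw [tailIntegral, (h.laterIncrement s).perpetualIntegral_eq]
          simp only [Set.indicator, Pi.one_apply]
          split_ifs <;> simp
  calc ∫⁻ s in Set.Ici (0 : ℝ), c * ∫⁻ ω, {y | x + y ∈ E}.indicator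
        (fun y => (f (x + y) : ℝ≥0∞)) (ξ s.toNNReal ω) ∂P
      ≤ ∫⁻ s in Set.Ici (0 : ℝ), ∫⁻ ω, (Set.Iic K).indicator
        (fun _ => (f (x + ξ s.toNNReal ω) : ℝ≥0∞)) (tailIntegral f ξ x s.toNNReal ω) ∂P :=
        lintegral_mono fun s => step _
    _ = ∫⁻ ω, (∫⁻ s in Set.Ici (0 : ℝ), (Set.Iic K).indicator
        (fun _ => (f (x + ξ s.toNNReal ω) : ℝ≥0∞)) (tailIntegral f ξ x s.toNNReal ω)) ∂P := by
        refine lintegral_lintegral_swap (f := fun (s : ℝ) ω => (Set.Iic K).indicator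
          (fun _ => (f (x + ξ s.toNNReal ω) : ℝ≥0∞)) (tailIntegral f ξ x s.toNNReal ω)) ?_
        have h0 : Measurable fun p : ℝ × Ω => (p.2, p.1.toNNReal) :=
          measurable_snd.prodMk (measurable_real_toNNReal.comp measurable_fst)
        have h1 : Measurable fun p : ℝ × Ω => (f (x + ξ p.1.toNNReal p.2) : ℝ≥0∞) :=
          hfx.comp (h.measurable_uncurry.comp h0)
        exact (h1.indicator (((h.measurable_tailIntegral hf x).comp h0)
          measurableSet_Iic)).aemeasurable
    _ ≤ ∫⁻ _, K ∂P := lintegral_mono fun ω => setLIntegral_tailIntegral_le f ξ x K ω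
    _ = K := by simp

end IsRegularLevy

/-! ### Finite potential implies finite integral -/

lemma LocallyBounded.exists_bound {f : ℝ → ℝ≥0} (hf : LocallyBounded f) (R : ℝ) :
    ∃ M : ℝ≥0, ∀ y, |y| ≤ R → f y ≤ M := by
  have : ∃ M : ℝ≥0, ∀ y ∈ Set.Icc (-R) R, f y ≤ M := by
    refine isCompact_Icc.induction_on (p := fun s => ∃ M : ℝ≥0, ∀ y ∈ s, f y ≤ M) ⟨0, by simp⟩
      (fun s t hst ⟨M, hM⟩ => ⟨M, fun y hy => hM y (hst hy)⟩)
      (fun s t ⟨M, hM⟩ ⟨M', hM'⟩ => ⟨max M M', fun y hy => ?_⟩) fun a _ => ?_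
    · exact hy.elim (fun h => (hM y h).trans (le_max_left _ _))
        fun h => (hM' y h).trans (le_max_right _ _)
    · obtain ⟨C, hC⟩ := hf a
      exact ⟨_, mem_nhdsWithin_of_mem_nhds hC, C, fun y hy => hy⟩
  obtain ⟨M, hM⟩ := this
  exact ⟨M, fun y hy => hM y (abs_le.1 hy)⟩

lemma perpetualIntegral_eq_add {Ω : Type*} (f : ℝ → ℝ≥0) (ξ : ℝ≥0 → Ω → ℝ) (y : ℝ) (T : ℝ≥0)
    (ω : Ω) : perpetualIntegral f ξ y ω =
      (∫⁻ s in Set.Ico (0 : ℝ) T, (f (y + ξ s.toNNReal ω) : ℝ≥0∞)) + tailIntegral f ξ y T ω := by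
  rw [tailIntegral_eq, perpetualIntegral, ← Set.Ico_union_Ici_eq_Ici T.2,
    lintegral_union measurableSet_Ici]
  · rfl
  · rw [Set.disjoint_left]
    exact fun s hs hs' => absurd hs.2 (not_lt.2 hs')

lemma setLIntegral_Ico_lt_top {g : ℝ → ℝ≥0} {T M : ℝ≥0}
    (h : ∀ s, 0 ≤ s → s < (T : ℝ) → g s ≤ M) : ∫⁻ s in Set.Ico (0 : ℝ) T, (g s : ℝ≥0∞) < ∞ := by
  calc ∫⁻ s in Set.Ico (0 : ℝ) T, (g s : ℝ≥0∞) ≤ ∫⁻ _ in Set.Ico (0 : ℝ) T, (M : ℝ≥0∞) :=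
        setLIntegral_mono measurable_const fun s hs => ENNReal.coe_le_coe.2 (h s hs.1 hs.2)
    _ < ∞ := by
        rw [setLIntegral_const, Real.volume_Ico]
        exact ENNReal.mul_lt_top ENNReal.coe_lt_top ENNReal.ofReal_lt_top

lemma DriftsToInfinity.ae_exists_forall_le {Ω : Type*} [MeasurableSpace Ω] {ξ : ℝ≥0 → Ω → ℝ}
    {P : Measure Ω} (h : DriftsToInfinity ξ P) (b : ℝ) :
    ∀ᵐ ω ∂P, ∃ τ : ℝ≥0, ∀ s, τ ≤ s → b ≤ ξ s ω := by
  filter_upwards [h] with ω hω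
  exact eventually_atTop.1 (hω.eventually_ge_atTop b)

lemma exists_pos_measure_le {Ω : Type*} [MeasurableSpace Ω] {P : Measure Ω} {ξ : ℝ≥0 → Ω → ℝ}
    {g : ℝ → ℝ≥0} {x : ℝ}     (hpos : P {ω | perpetualIntegral g ξ x ω < ∞} ≠ 0) :
    ∃ K : ℕ, P (perpetualIntegral g ξ x ⁻¹' Set.Iic (K : ℝ≥0∞)) ≠ 0 := by
  by_contra! hcon
  refine hpos (measure_mono_null (fun ω hω => ?_) (measure_iUnion_null hcon))
  obtain ⟨n, hn⟩ := ENNReal.exists_nat_gt (ne_of_lt (show perpetualIntegral g ξ x ω < ∞ from hω))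
  exact Set.mem_iUnion.2 ⟨n, hn.le⟩

namespace IsRegularLevy

variable {Ω : Type*} [MeasurableSpace Ω] {P : Measure Ω} [IsProbabilityMeasure P]
  {ξ : ℝ≥0 → Ω → ℝ} {f : ℝ → ℝ≥0}

/-- On `[0, T)` the path is bounded and f is bounded on its range, so this piece never matters. One
null set serves all starting points and all T. -/
lemma ae_perpetualIntegral_lt_top_iff (h : IsRegularLevy ξ P) (hbdd : LocallyBounded f) :
    ∀ᵐ ω ∂P, ∀ (y : ℝ) (T : ℝ≥0),
      perpetualIntegral f ξ y ω < ∞ ↔ tailIntegral f ξ y T ω < ∞ := by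
  filter_upwards [h.ae_locally_bounded] with ω hω y T
  obtain ⟨C, hC⟩ := hω T
  obtain ⟨M, hM⟩ := hbdd.exists_bound (|y| + C)
  have hfin : ∫⁻ s in Set.Ico (0 : ℝ) T, (f (y + ξ s.toNNReal ω) : ℝ≥0∞) < ∞ := by
    refine setLIntegral_Ico_lt_top (M := M) fun s hs hsT => hM _ ?_
    refine (abs_add_le _ _).trans (add_le_add_right (hC _ ?_) _)
    exact Real.toNNReal_le_iff_le_coe.2 hsT.le
  rw [perpetualIntegral_eq_add f ξ y T ω, ENNReal.add_lt_top]
  exact and_iff_right hfin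

/-- If the potential of `f` is finite off a transient set, then the perpetual integral is almost
surely finite. -/
lemma ae_perpetualIntegral_lt_top (h : IsRegularLevy ξ P) (hf : Measurable f)
    (hbdd : LocallyBounded f) {x : ℝ} {E : Set ℝ} (hE : MeasurableSet E)
    (htr : ∀ᵐ ω ∂P, ∃ τ : ℝ≥0, ∀ s, τ ≤ s → x + ξ s ω ∈ E)
    (hfin : ∫⁻ y in {y | x + y ∈ E}, (f (x + y) : ℝ≥0∞) ∂(potentialMeasure ξ P) < ∞) :
    ∀ᵐ ω ∂P, perpetualIntegral f ξ x ω < ∞ := by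
  have hE' : MeasurableSet {y | x + y ∈ E} := (measurable_const_add x) hE
  have hg : Measurable fun y => {y | x + y ∈ E}.indicator (fun y => (f (x + y) : ℝ≥0∞)) y :=
    (hf.comp (measurable_const_add x)).coe_nnreal_ennreal.indicator hE'
  rw [← lintegral_indicator hE', h.lintegral_potentialMeasure_swap hg] at hfin
  have hm : Measurable fun ω => ∫⁻ s in Set.Ici (0 : ℝ),
      {y | x + y ∈ E}.indicator (fun y => (f (x + y) : ℝ≥0∞)) (ξ s.toNNReal ω) := by
    refine Measurable.lintegral_prod_right' (f := fun p : Ω × ℝ =>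
      {y | x + y ∈ E}.indicator (fun y => (f (x + y) : ℝ≥0∞)) (ξ p.2.toNNReal p.1)) ?_
    exact hg.comp (h.measurable_uncurry.comp (f := fun p : Ω × ℝ => (p.1, p.2.toNNReal))
      (measurable_fst.prodMk (measurable_real_toNNReal.comp measurable_snd)))
  filter_upwards [ae_lt_top hm hfin.ne, htr, h.ae_perpetualIntegral_lt_top_iff hbdd]
    with ω h1 ⟨τ, hτ⟩ h3
  rw [h3 x τ, tailIntegral_eq]
  refine lt_of_le_of_lt ?_ h1
  calc ∫⁻ s in Set.Ici (τ : ℝ), (f (x + ξ s.toNNReal ω) : ℝ≥0∞)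
      = ∫⁻ s in Set.Ici (τ : ℝ),
        {y | x + y ∈ E}.indicator (fun y => (f (x + y) : ℝ≥0∞)) (ξ s.toNNReal ω) := by
        refine setLIntegral_congr_fun measurableSet_Ici fun s hs => ?_
        have hs' : ξ s.toNNReal ω ∈ {y | x + y ∈ E} := hτ _ (NNReal.le_toNNReal_of_coe_le hs)
        rw [Set.indicator_of_mem hs']
    _ ≤ _ := lintegral_mono_set (Set.Ici_subset_Ici.2 τ.coe_nonneg)

/-! ### Converse for ultimately non-increasing integrands -/

/-- The hard implication for ultimately non-increasing integrands. -/
lemma exists_of_antitoneOn (h : IsRegularLevy ξ P) (hdrift : DriftsToInfinity ξ P)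
    (hf : Measurable f) {l : ℝ} (hl : AntitoneOn f (Set.Ici l)) {x : ℝ}
    (hpos : P {ω | perpetualIntegral f ξ x ω < ∞} ≠ 0) :
    ∃ E, MeasurableSet E ∧ (∀ᵐ ω ∂P, ∃ τ : ℝ≥0, ∀ s, τ ≤ s → x + ξ s ω ∈ E) ∧
      ∫⁻ y in {y | x + y ∈ E}, (f (x + y) : ℝ≥0∞) ∂(potentialMeasure ξ P) < ∞ := by
  -- Freezing f below l makes it non-increasing everywhere and bounded by `f l`. Since the path ends
  -- up above l, finiteness of the integral of f passes to g.
  set g : ℝ → ℝ≥0 := fun y => f (max y l) with hgdef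
  have hg : Measurable g := hf.comp (measurable_id.max measurable_const)
  have hanti : Antitone g := fun a b hab =>
    hl (Set.mem_Ici.2 (le_max_right _ _)) (Set.mem_Ici.2 (le_max_right _ _))
      (max_le_max_right l hab)
  have hgl : ∀ y, g y ≤ f l := fun y => hl (Set.mem_Ici.2 le_rfl) (Set.mem_Ici.2 (le_max_right _ _))
    (le_max_right _ _)
  have hgf : ∀ y, l ≤ y → g y = f y := fun y hy => by simp only [hgdef, max_eq_left hy]
  have hpos' : P {ω | perpetualIntegral g ξ x ω < ∞} ≠ 0 := by
    intro h0
    refine hpos (measure_mono_null_ae ?_ h0)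
    filter_upwards [hdrift.ae_exists_forall_le (l - x)] with ω ⟨τ, hτ⟩ hω
    change perpetualIntegral g ξ x ω < ∞
    rw [perpetualIntegral_eq_add g ξ x τ ω, ENNReal.add_lt_top]
    refine ⟨setLIntegral_Ico_lt_top (M := f l) fun s _ _ => hgl _, ?_⟩
    refine lt_of_eq_of_lt ?_ (lt_of_le_of_lt (tailIntegral_antitone f ξ x ω (zero_le (a := τ)))
      (lt_of_eq_of_lt (tailIntegral_zero f ξ x ω) hω))
    simp only [tailIntegral_eq]
    refine setLIntegral_congr_fun measurableSet_Ici fun s hs => ?_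
    have := hτ _ (NNReal.le_toNNReal_of_coe_le hs)
    rw [hgf _ (by linarith)]
  obtain ⟨K, hK⟩ := exists_pos_measure_le hpos'
  -- Taking c to be the probability at x itself puts every y above both x and l into `E`, by
  -- monotonicity.
  set c := perpetualProb g ξ P (Set.Iic (K : ℝ≥0∞)) x with hc
  have hc0 : c ≠ 0 := hK
  set E : Set ℝ := {y | l ≤ y ∧ c ≤ perpetualProb g ξ P (Set.Iic (K : ℝ≥0∞)) y} with hEdef
  have hE : MeasurableSet E := measurableSet_Ici.inter
    (measurableSet_le measurable_const (h.measurable_perpetualProb hg measurableSet_Iic))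
  have hmono : Monotone (perpetualProb g ξ P (Set.Iic (K : ℝ≥0∞))) := fun a b hab =>
    measure_mono fun ω hω => (lintegral_mono fun s =>
      ENNReal.coe_le_coe.2 (hanti (add_le_add_left hab _))).trans hω
  refine ⟨E, hE, ?_, ?_⟩
  -- The bound `l - x` lifts the path above l, the bound 0 lifts it above x.
  · filter_upwards [hdrift.ae_exists_forall_le (max (l - x) 0)] with ω ⟨τ, hτ⟩
    refine ⟨τ, fun s hs => ⟨?_, hmono ?_⟩⟩
    · have := (le_max_left _ _).trans (hτ s hs)
      linarith
    · have := (le_max_right _ _).trans (hτ s hs)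
      linarith
  · have key := h.mul_setLIntegral_potentialMeasure_le hg x (measure_ne_top _ _) hE
      (K := K) (c := c) fun y hy => hy.2
    have e : ∫⁻ y in {y | x + y ∈ E}, (f (x + y) : ℝ≥0∞) ∂(potentialMeasure ξ P) =
        ∫⁻ y in {y | x + y ∈ E}, (g (x + y) : ℝ≥0∞) ∂(potentialMeasure ξ P) :=
      setLIntegral_congr_fun ((measurable_const_add x) hE) fun y hy => by
        rw [hgf _ hy.1]
    rw [e]
    by_contra hcon
    rw [not_lt, top_le_iff] at hcon
    rw [hcon, ENNReal.mul_top hc0] at key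
    exact absurd key (not_le.2 (ENNReal.natCast_lt_top K))

end IsRegularLevy

/-! ### Choquet–Deny by a variance argument -/

/-- A bounded function which is harmonic for the random walk with step distribution `μ` does not
change along the steps of the walk (Choquet–Deny). -/
theorem ae_eq_of_forall_integral_eq {μ : Measure ℝ} [IsProbabilityMeasure μ] {u : ℝ → ℝ}
    (hu : Measurable u) (h0 : ∀ y, 0 ≤ u y) (h1 : ∀ y, u y ≤ 1)
    (hμ : ∀ y, ∫ a, u (y + a) ∂μ = u y) (x : ℝ) : ∀ᵐ a ∂μ, u (x + a) = u x := by
  set D : ℝ → ℝ := fun y => ∫ a, (u (y + a) - u y) ^ 2 ∂μ with hD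
  have hbd : ∀ y z, |u y - u z| ≤ 1 := fun y z => by
    rw [abs_le]; constructor <;> linarith [h0 y, h1 y, h0 z, h1 z]
  have hint : ∀ {α : Type} [MeasurableSpace α] {ν : Measure α} [IsFiniteMeasure ν] {g : α → ℝ},
      Measurable g → (∀ b, |g b| ≤ 1) → Integrable g ν := fun hg hb =>
    Integrable.of_bound hg.aestronglyMeasurable 1 (Eventually.of_forall hb)
  have hu_shift : ∀ y, Measurable fun a => u (y + a) := fun y => hu.comp (measurable_const_add y)
  have hu_abs : ∀ y, |u y| ≤ 1 := fun y => abs_le.2 ⟨by linarith [h0 y], h1 y⟩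
  have hsq_abs : ∀ {r : ℝ}, |r| ≤ 1 → |r ^ 2| ≤ 1 := fun {r} hr => by
    rw [abs_pow]; exact pow_le_one₀ (abs_nonneg _) hr
  have hDm2 : Measurable fun p : ℝ × ℝ => (u (p.1 + p.2) - u p.1) ^ 2 := by fun_prop
  have hDm : Measurable D :=
    (StronglyMeasurable.integral_prod_right (f := fun y a => (u (y + a) - u y) ^ 2)
      hDm2.stronglyMeasurable).measurable
  have hD0 : ∀ y, 0 ≤ D y := fun y => integral_nonneg fun a => sq_nonneg _
  have hD1 : ∀ y, D y ≤ 1 := fun y => by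
    calc D y ≤ ∫ _, (1 : ℝ) ∂μ := integral_mono
          (hint (by fun_prop) fun a => hsq_abs (hbd _ _)) (integrable_const _)
          fun a => (le_abs_self _).trans (hsq_abs (hbd _ _))
      _ = 1 := by simp
  have hexp : ∀ g : ℝ → ℝ, Measurable g → (∀ b, |g b| ≤ 1) → ∀ c : ℝ,
      ∫ b, (g b - c) ^ 2 ∂μ = ∫ b, g b ^ 2 ∂μ - 2 * c * ∫ b, g b ∂μ + c ^ 2 := fun g hg hb c => by
    have i1 : Integrable (fun a => g a ^ 2) μ := hint (by fun_prop) fun a => hsq_abs (hb _)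
    have i2 : Integrable (fun a => 2 * c * g a) μ := (hint hg hb).const_mul _
    have i3 : Integrable (fun a => g a ^ 2 - 2 * c * g a) μ := i1.sub i2
    have e : ∀ a, (g a - c) ^ 2 = g a ^ 2 - 2 * c * g a + c ^ 2 := fun a => by ring
    simp only [e]
    rw [integral_add i3 (integrable_const _), integral_sub i1 i2, integral_const_mul]
    simp
  -- `D` is the one-step variance: by harmonicity it is exactly the mean growth of `u ^ 2` over a
  -- step.
  have hDv : ∀ y, ∫ a, u (y + a) ^ 2 ∂μ = u y ^ 2 + D y := fun y => by
    have := hexp (fun a => u (y + a)) (by fun_prop) (fun a => hu_abs _) (u y)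
    rw [hμ] at this
    simp only [hD, this]
    ring
  have jensen : ∀ g : ℝ → ℝ, Measurable g → (∀ b, |g b| ≤ 1) →
      (∫ b, g b ∂μ) ^ 2 ≤ ∫ b, g b ^ 2 ∂μ := fun g hg hb => by
    set c := ∫ b, g b ∂μ with hc
    have hnn : 0 ≤ ∫ b, (g b - c) ^ 2 ∂μ := integral_nonneg fun a => sq_nonneg _
    rw [hexp g hg hb, ← hc] at hnn
    nlinarith
  -- `D` is subharmonic: harmonicity at `y + a` and at y, with commutativity of addition, writes `u
  -- (y + a) - u y` as a mean over b of the same difference at `y + b`; then Jensen.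
  have hsub : ∀ y, D y ≤ ∫ b, D (y + b) ∂μ := fun y => by
    have hm3 : Measurable fun p : ℝ × ℝ => (u (y + p.2 + p.1) - u (y + p.2)) ^ 2 := by fun_prop
    calc D y = ∫ a, (∫ b, (u (y + b + a) - u (y + b)) ∂μ) ^ 2 ∂μ := by
          refine integral_congr_ae (Eventually.of_forall fun a => ?_)
          simp only
          rw [integral_sub (hint (by fun_prop) fun b => hu_abs _)
            (hint (by fun_prop) fun b => hu_abs _), hμ]
          simp only [add_right_comm y _ a]
          rw [hμ]
      _ ≤ ∫ a, ∫ b, (u (y + b + a) - u (y + b)) ^ 2 ∂μ ∂μ := by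
          have i2 : Integrable (fun p : ℝ × ℝ => (u (y + p.2 + p.1) - u (y + p.2)) ^ 2)
              (μ.prod μ) := hint hm3 fun p => hsq_abs (hbd _ _)
          refine integral_mono_of_nonneg (Eventually.of_forall fun a => sq_nonneg _)
            i2.integral_prod_left (Eventually.of_forall fun a => ?_)
          exact jensen _ (by fun_prop) fun b => hbd _ _
      _ = ∫ b, ∫ a, (u (y + b + a) - u (y + b)) ^ 2 ∂μ ∂μ :=
          integral_integral_swap (f := fun a b => (u (y + b + a) - u (y + b)) ^ 2)
            (hint hm3 fun p => hsq_abs (hbd _ _))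
      _ = ∫ b, D (y + b) ∂μ := rfl
  -- Averaging the bound for n over one step gains one `D` from `u ^ 2` and loses nothing in `n *
  -- D`. Since n is arbitrary, `D` vanishes.
  have hind : ∀ n : ℕ, ∀ y, u y ^ 2 + n * D y ≤ 1 := by
    intro n
    induction n with
    | zero => intro y; simpa using (le_abs_self _).trans (hsq_abs (hu_abs y))
    | succ n ih =>
      intro y
      have i1 : Integrable (fun a => u (y + a) ^ 2) μ :=
        hint (by fun_prop) fun a => hsq_abs (hu_abs _)
      have i2 : Integrable (fun a => D (y + a)) μ :=
        hint (by fun_prop) fun a => abs_le.2 ⟨by linarith [hD0 (y + a)], hD1 _⟩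
      have : ∫ a, (u (y + a) ^ 2 + n * D (y + a)) ∂μ ≤ ∫ _, (1 : ℝ) ∂μ :=
        integral_mono (i1.add (i2.const_mul _)) (integrable_const _) fun a => ih _
      rw [integral_add i1 (i2.const_mul _), integral_const_mul, hDv] at this
      simp at this
      have := mul_le_mul_of_nonneg_left (hsub y) (Nat.cast_nonneg (α := ℝ) n)
      push_cast
      linarith
  have hDx : D x = 0 := by
    refine le_antisymm (le_of_forall_pos_lt_add fun ε hε => ?_) (hD0 x)
    obtain ⟨n, hn⟩ := exists_nat_gt (1 / ε)
    have h2 := hind n x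
    rw [div_lt_iff₀ hε] at hn
    have hnp : 0 < (n : ℝ) := by
      rcases Nat.eq_zero_or_pos n with rfl | h
      · simp at hn; linarith
      · exact_mod_cast h
    by_contra hcon
    have := mul_le_mul_of_nonneg_left (not_lt.1 hcon) hnp.le
    nlinarith [sq_nonneg (u x)]
  have hz := (integral_eq_zero_iff_of_nonneg (fun a => sq_nonneg _)
    (hint (ν := μ) (((hu_shift x).sub_const _).pow_const 2) fun a => hsq_abs (hbd _ _))).1 hDx
  filter_upwards [hz] with a ha
  have : (u (x + a) - u x) ^ 2 = 0 := ha
  linarith [pow_eq_zero_iff (two_ne_zero) |>.1 this]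

/-! ### Zero-one law and converse for continuous integrands -/

/-- For a continuous integrand, the perpetual integral depends lower semicontinuously on the
starting point. -/
lemma perpetualIntegral_le_liminf {Ω : Type*} {f : ℝ → ℝ≥0} {ξ : ℝ≥0 → Ω → ℝ} (hf : Continuous f)
    {ω : Ω} (hm : Measurable fun t => ξ t ω) {y : ℕ → ℝ} {z : ℝ} (hy : Tendsto y atTop (𝓝 z)) :
    perpetualIntegral f ξ z ω ≤ liminf (fun n => perpetualIntegral f ξ (y n) ω) atTop := by
  have hlim : ∀ s : ℝ, liminf (fun n => (f (y n + ξ s.toNNReal ω) : ℝ≥0∞)) atTop =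
      f (z + ξ s.toNNReal ω) := fun s => by
    refine Tendsto.liminf_eq (ENNReal.tendsto_coe.2 ?_)
    exact (hf.tendsto _).comp (hy.add_const _)
  calc perpetualIntegral f ξ z ω
      = ∫⁻ s in Set.Ici (0 : ℝ), liminf (fun n => (f (y n + ξ s.toNNReal ω) : ℝ≥0∞)) atTop := by
        simp only [hlim]
        rfl
    _ ≤ _ := lintegral_liminf_le fun n => (hf.measurable.comp
        (measurable_const.add (hm.comp measurable_real_toNNReal))).coe_nnreal_ennreal

/-- A finite perpetual integral has eventually small tails. -/
lemma exists_tailIntegral_le_one {Ω : Type*} {f : ℝ → ℝ≥0} {ξ : ℝ≥0 → Ω → ℝ} {x : ℝ} {ω : Ω}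
    (h : perpetualIntegral f ξ x ω < ∞) : ∃ m : ℕ, tailIntegral f ξ x m ω ≤ 1 := by
  set ν := (volume : Measure ℝ).withDensity fun s => (f (x + ξ s.toNNReal ω) : ℝ≥0∞) with hν
  have hval : ∀ m : ℕ, ν (Set.Ici (m : ℝ)) = tailIntegral f ξ x m ω := fun m => by
    rw [hν, withDensity_apply _ measurableSet_Ici, tailIntegral_eq]
    rfl
  have := tendsto_measure_iInter_atTop (μ := ν) (s := fun m : ℕ => Set.Ici (m : ℝ))
    (fun m => measurableSet_Ici.nullMeasurableSet)
    (fun a b hab => Set.Ici_subset_Ici.2 (Nat.cast_le.2 hab)) ⟨0, by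
      rw [hval, Nat.cast_zero, tailIntegral_zero]; exact h.ne⟩
  have he : ⋂ m : ℕ, Set.Ici (m : ℝ) = ∅ := by
    refine Set.eq_empty_of_forall_notMem fun s hs => ?_
    obtain ⟨n, hn⟩ := exists_nat_gt s
    exact absurd (Set.mem_iInter.1 hs n) (not_le.2 hn)
  rw [he, measure_empty] at this
  obtain ⟨m, hm⟩ := (this.eventually (gt_mem_nhds one_pos)).exists
  exact ⟨m, (hval m).symm.trans_le hm.le⟩

namespace IsRegularLevy

variable {Ω : Type*} [MeasurableSpace Ω] {P : Measure Ω} {ξ : ℝ≥0 → Ω → ℝ} {f : ℝ → ℝ≥0}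

lemma measurable_path (h : IsRegularLevy ξ P) (ω : Ω) : Measurable fun t => ξ t ω :=
  h.measurable_uncurry.comp (f := fun t => (ω, t)) (measurable_const.prodMk measurable_id)

/-- The integral over `[0, n)` is a function of the past up to time `n`. -/
lemma measurableSet_pastSigma_setLIntegral_le (h : IsRegularLevy ξ P) (hf : Measurable f) (x : ℝ)
    (n : ℝ≥0) (K : ℝ≥0∞) : MeasurableSet[pastSigma ξ n]
      {ω | ∫⁻ s in Set.Ico (0 : ℝ) n, (f (x + ξ s.toNNReal ω) : ℝ≥0∞) ≤ K} := by
  refine ⟨{w | ∫⁻ s in Set.Ico (0 : ℝ) n, (f (x + pathEval w s.toNNReal) : ℝ≥0∞) ≤ K}, ?_, ?_⟩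
  · have hm : Measurable fun w : ℝ≥0 → ℝ =>
        ∫⁻ s in Set.Ico (0 : ℝ) n, (f (x + pathEval w s.toNNReal) : ℝ≥0∞) := by
      refine Measurable.lintegral_prod_right'
        (f := fun q : (ℝ≥0 → ℝ) × ℝ => (f (x + pathEval q.1 q.2.toNNReal) : ℝ≥0∞)) ?_
      have h1 : Measurable fun q : (ℝ≥0 → ℝ) × ℝ => (q.1, q.2.toNNReal) :=
        measurable_fst.prodMk (measurable_real_toNNReal.comp measurable_snd)
      exact (hf.comp (measurable_const.add (measurable_pathEval.comp h1))).coe_nnreal_ennreal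
    exact hm measurableSet_Iic
  · ext ω
    have e : ∫⁻ s in Set.Ico (0 : ℝ) n,
        (f (x + pathEval (fun t => ξ (min t n) ω) s.toNNReal) : ℝ≥0∞) =
        ∫⁻ s in Set.Ico (0 : ℝ) n, (f (x + ξ s.toNNReal ω) : ℝ≥0∞) := by
      refine setLIntegral_congr_fun measurableSet_Ico fun s hs => ?_
      have hc : ContinuousWithinAt (fun t => ξ (min t n) ω) (Set.Ici s.toNNReal) s.toNNReal :=
        (h.continuousWithinAt ω (min s.toNNReal n)).comp (f := fun t => min t n)
          (by fun_prop) (fun t ht => min_le_min_right n ht)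
      have hsn : s.toNNReal ≤ n := Real.toNNReal_le_iff_le_coe.2 hs.2.le
      simp only [pathEval_eq hc, min_eq_left hsn]
    change _ ≤ K ↔ _ ≤ K
    rw [e]

variable [IsProbabilityMeasure P]

/-- Along `y_n → z` the event that `I_{y_n} ≤ K` infinitely often still has probability at least c,
and on it Fatou gives `I_z ≤ K`. Closedness makes the complement open, so that visits to it are
detected at dense times. -/
lemma isClosed_perpetualProb (h : IsRegularLevy ξ P) (hf : Continuous f) (K c : ℝ≥0∞) :
    IsClosed {y | c ≤ perpetualProb f ξ P (Set.Iic K) y} := by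
  refine IsSeqClosed.isClosed fun y z hy hyz => ?_
  set A : ℕ → Set Ω := fun n => perpetualIntegral f ξ (y n) ⁻¹' Set.Iic K with hA
  have hAm : ∀ n, MeasurableSet (A n) := fun n =>
    ((h.measurable_perpetualIntegral hf.measurable).comp measurable_prodMk_left) measurableSet_Iic
  have hlim := tendsto_measure_iInter_atTop (μ := P) (s := fun n => ⋃ k, ⋃ (_ : n ≤ k), A k)
    (fun n => (MeasurableSet.iUnion fun k => MeasurableSet.iUnion fun _ =>
      hAm k).nullMeasurableSet)
    (fun a b hab ω hω => by
      simp only [Set.mem_iUnion] at hω ⊢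
      obtain ⟨k, hk, hω⟩ := hω
      exact ⟨k, hab.trans hk, hω⟩) ⟨0, measure_ne_top _ _⟩
  refine (ge_of_tendsto' hlim fun n => (hy n).trans (measure_mono ?_)).trans (measure_mono ?_)
  · exact Set.subset_iUnion₂_of_subset n le_rfl subset_rfl
  · intro ω hω
    refine (perpetualIntegral_le_liminf hf (h.measurable_path ω) hyz).trans
      (liminf_le_of_frequently_le' ?_)
    rw [frequently_atTop]
    intro n
    have := Set.mem_iInter.1 hω n
    simp only [Set.mem_iUnion] at this
    obtain ⟨k, hk, hω⟩ := this
    exact ⟨k, hk, hω⟩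

/-- The probability of finiteness of the perpetual integral does not change along the path. -/
lemma ae_perpetualProb_eq (h : IsRegularLevy ξ P) (hf : Measurable f) (hbdd : LocallyBounded f)
    (x : ℝ) (t : ℝ≥0) : ∀ᵐ ω ∂P, perpetualProb f ξ P (Set.Iio ∞) (x + ξ t ω) =
      perpetualProb f ξ P (Set.Iio ∞) x := by
  have hpm := h.measurable_perpetualProb hf (S := Set.Iio ∞) measurableSet_Iio
  have hprob : IsProbabilityMeasure (P.map (ξ t)) :=
    Measure.isProbabilityMeasure_map (h.measurable t).aemeasurable
  have hle : ∀ y, perpetualProb f ξ P (Set.Iio ∞) y ≤ 1 := fun y => prob_le_one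
  -- Harmonicity: finiteness of the integral is decided after time t, where the Markov property
  -- applies.
  have hharm : ∀ y, ∫⁻ ω, perpetualProb f ξ P (Set.Iio ∞) (y + ξ t ω) ∂P =
      perpetualProb f ξ P (Set.Iio ∞) y := fun y => by
    have := h.measure_inter_tailIntegral hf y (s := t) (B := Set.univ) MeasurableSet.univ
      (S := Set.Iio ∞) measurableSet_Iio
    rw [Measure.restrict_univ, Set.univ_inter] at this
    rw [← this, perpetualProb]
    refine measure_congr ?_
    filter_upwards [h.ae_perpetualIntegral_lt_top_iff hbdd] with ω hω
    exact propext (hω y t).symm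
  have key := ae_eq_of_forall_integral_eq (μ := P.map (ξ t))
    (u := fun y => (perpetualProb f ξ P (Set.Iio ∞) y).toReal) hpm.ennreal_toReal
    (fun y => ENNReal.toReal_nonneg) (fun y => ENNReal.toReal_le_of_le_ofReal zero_le_one
      (by simpa using hle y)) (fun y => ?_) x
  · filter_upwards [ae_of_ae_map (h.measurable t).aemeasurable key] with ω hω
    exact (ENNReal.toReal_eq_toReal_iff' (ne_top_of_le_ne_top ENNReal.one_ne_top (hle _))
      (ne_top_of_le_ne_top ENNReal.one_ne_top (hle _))).1 hω
  · have hpm' : Measurable fun a => perpetualProb f ξ P (Set.Iio ∞) (y + a) :=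
      hpm.comp (measurable_const_add y)
    rw [integral_map (h.measurable t).aemeasurable hpm'.ennreal_toReal.aestronglyMeasurable,
      integral_toReal (f := fun ω => perpetualProb f ξ P (Set.Iio ∞) (y + ξ t ω))
        (hpm'.comp (h.measurable t)).aemeasurable
        (Eventually.of_forall fun ω => (hle _).trans_lt ENNReal.one_lt_top), hharm]

/-- The zero-one law for the finiteness of a perpetual integral. -/
lemma ae_perpetualIntegral_lt_top_of_pos (h : IsRegularLevy ξ P) (hf : Measurable f)
    (hbdd : LocallyBounded f) {x : ℝ} (hpos : P {ω | perpetualIntegral f ξ x ω < ∞} ≠ 0) :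
    ∀ᵐ ω ∂P, perpetualIntegral f ξ x ω < ∞ := by
  obtain ⟨K, hK⟩ := exists_pos_measure_le hpos
  set p := perpetualProb f ξ P (Set.Iio ∞) x with hp
  set A := perpetualIntegral f ξ x ⁻¹' Set.Iio ∞ with hA
  -- These events depend on the past only and decrease to `{I_x ≤ K}`, which lies inside `A`.
  set B : ℕ → Set Ω := fun n =>
    {ω | ∫⁻ s in Set.Ico (0 : ℝ) (n : ℝ≥0), (f (x + ξ s.toNNReal ω) : ℝ≥0∞) ≤ K} with hB
  have hIm : Measurable (perpetualIntegral f ξ x) :=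
    (h.measurable_perpetualIntegral hf).comp measurable_prodMk_left
  have hAm : MeasurableSet A := hIm measurableSet_Iio
  have hBpast : ∀ n : ℕ, MeasurableSet[pastSigma ξ n] (B n) := fun n =>
    h.measurableSet_pastSigma_setLIntegral_le hf x n K
  have hBm : ∀ n, MeasurableSet (B n) := fun n => h.pastSigma_le _ _ (hBpast n)
  have hBA : ∀ n, P (B n ∩ A) = p * P (B n) := fun n => by
    have e1 : P (B n ∩ A) = P (B n ∩ tailIntegral f ξ x n ⁻¹' Set.Iio ∞) := by
      refine measure_congr ?_
      filter_upwards [h.ae_perpetualIntegral_lt_top_iff hbdd] with ω hω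
      exact propext (and_congr_right fun _ => hω x n)
    rw [e1, h.measure_inter_tailIntegral hf x (hBpast n) measurableSet_Iio,
      lintegral_congr_ae (g := fun _ => p) (ae_restrict_of_ae (h.ae_perpetualProb_eq hf hbdd x n)),
      setLIntegral_const]
  have hBanti : Antitone B := fun a b hab ω (hω : _ ≤ _) =>
    show _ ≤ _ from (lintegral_mono_set (Set.Ico_subset_Ico_right (by exact_mod_cast hab))).trans hω
  have hBinter : ⋂ n, B n = perpetualIntegral f ξ x ⁻¹' Set.Iic (K : ℝ≥0∞) := by
    have hU : ⋃ n : ℕ, Set.Ico (0 : ℝ) (n : ℝ≥0) = Set.Ici 0 := by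
      ext s
      simp only [Set.mem_iUnion, Set.mem_Ico, Set.mem_Ici]
      refine ⟨fun ⟨_, hs, _⟩ => hs, fun hs => ?_⟩
      obtain ⟨n, hn⟩ := exists_nat_gt s
      exact ⟨n, hs, by exact_mod_cast hn⟩
    have hmono : Monotone fun n : ℕ => Set.Ico (0 : ℝ) (n : ℝ≥0) := fun a b hab =>
      Set.Ico_subset_Ico_right (by exact_mod_cast hab)
    ext ω
    rw [Set.mem_iInter, Set.mem_preimage, Set.mem_Iic, perpetualIntegral, ← hU,
      setLIntegral_iUnion_of_directed _ hmono.directed_le, iSup_le_iff]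
    rfl
  have l1 := tendsto_measure_iInter_atTop (μ := P) (fun n => (hBm n).nullMeasurableSet) hBanti
    ⟨0, measure_ne_top _ _⟩
  have l2 := tendsto_measure_iInter_atTop (μ := P) (s := fun n => B n ∩ A)
    (fun n => ((hBm n).inter hAm).nullMeasurableSet)
    (fun a b hab => Set.inter_subset_inter_left _ (hBanti hab)) ⟨0, measure_ne_top _ _⟩
  have hsub : perpetualIntegral f ξ x ⁻¹' Set.Iic (K : ℝ≥0∞) ⊆ A := fun ω (hω : _ ≤ _) =>
    show _ < _ from hω.trans_lt (ENNReal.natCast_lt_top K)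
  have hptop : p ≠ ∞ := measure_ne_top _ _
  simp only [Function.comp_def, hBA] at l2
  rw [← Set.iInter_inter, hBinter, Set.inter_eq_left.2 hsub] at l2
  rw [hBinter] at l1
  -- In the limit, `q = p q` for `q = P(I_x ≤ K)`, which is nonzero.
  have hq := tendsto_nhds_unique l2 (ENNReal.Tendsto.const_mul l1 (Or.inr hptop))
  have hp1 : p = 1 := by
    have := (ENNReal.mul_eq_right hK (measure_ne_top _ _)).1 hq.symm
    exact this
  exact (prob_compl_eq_zero_iff hAm).2 hp1

/-- The hard implication for continuous integrands. -/
lemma exists_of_continuous (h : IsRegularLevy ξ P) (hf : Continuous f)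
    (hbdd : LocallyBounded f) {x : ℝ} (hpos : P {ω | perpetualIntegral f ξ x ω < ∞} ≠ 0) :
    ∃ E, MeasurableSet E ∧ (∀ᵐ ω ∂P, ∃ τ : ℝ≥0, ∀ s, τ ≤ s → x + ξ s ω ∈ E) ∧
      ∫⁻ y in {y | x + y ∈ E}, (f (x + y) : ℝ≥0∞) ∂(potentialMeasure ξ P) < ∞ := by
  have hfm := hf.measurable
  have hfin := h.ae_perpetualIntegral_lt_top_of_pos hfm hbdd hpos
  -- With level 1/2, a start outside `E` makes the integral exceed 1 with probability at least 1/2.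
  set E := {y | 2⁻¹ ≤ perpetualProb f ξ P (Set.Iic 1) y} with hEdef
  have hEc : IsClosed E := h.isClosed_perpetualProb hf 1 2⁻¹
  have hO : IsOpen {y | x + y ∈ Eᶜ} := hEc.isOpen_compl.preimage (continuous_const_add x)
  have htm : ∀ s, Measurable (tailIntegral f ξ x s) := fun s =>
    (h.measurable_tailIntegral hfm x).comp (f := fun ω => (ω, s))
      (measurable_id.prodMk measurable_const)
  have hmax : ∀ m : ℕ, 2⁻¹ * P {ω | ∃ s, (m : ℝ≥0) ≤ s ∧ x + ξ s ω ∉ E} ≤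
      P (tailIntegral f ξ x m ⁻¹' Set.Ioi 1) := by
    intro m
    refine le_trans (mul_le_mul_right (measure_mono ?_) _) (mul_measure_iUnion_le (pastSigma ξ)
      h.pastSigma_le (monotone_pastSigma ξ) (bad := fun s => ξ s ⁻¹' {y | x + y ∈ Eᶜ})
      (fun s => measurable_pastSigma ξ le_rfl hO.measurableSet)
      (htm m measurableSet_Ioi) (α := 2⁻¹)
      (fun n => m + TopologicalSpace.denseSeq ℝ≥0 n) fun n B hB hsub => ?_)
    · rintro ω ⟨s, hs, hsE⟩
      obtain ⟨n, _, hn⟩ := h.exists_denseSeq_mem ω hs (lt_add_of_pos_right s one_pos) hO hsE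
      exact Set.mem_iUnion.2 ⟨n, hn⟩
    · set s := (m : ℝ≥0) + TopologicalSpace.denseSeq ℝ≥0 n with hs
      have hBm := h.pastSigma_le s _ hB
      calc 2⁻¹ * P B = ∫⁻ _ in B, 2⁻¹ ∂P := by rw [setLIntegral_const]
        _ ≤ ∫⁻ ω in B, perpetualProb f ξ P (Set.Ioi 1) (x + ξ s ω) ∂P := by
          refine setLIntegral_mono' hBm fun ω hω => ?_
          have hlt : perpetualProb f ξ P (Set.Iic 1) (x + ξ s ω) < 2⁻¹ := not_le.1 (hsub hω)
          have hm1 : MeasurableSet (perpetualIntegral f ξ (x + ξ s ω) ⁻¹' Set.Iic 1) :=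
            ((h.measurable_perpetualIntegral hfm).comp measurable_prodMk_left) measurableSet_Iic
          have e : perpetualProb f ξ P (Set.Ioi 1) (x + ξ s ω) =
              1 - perpetualProb f ξ P (Set.Iic 1) (x + ξ s ω) := by
            rw [perpetualProb, perpetualProb, ← prob_compl_eq_one_sub hm1, ← Set.preimage_compl,
              Set.compl_Iic]
          rw [e, ← ENNReal.one_sub_inv_two]
          exact tsub_le_tsub_left hlt.le 1
        _ = P (B ∩ tailIntegral f ξ x s ⁻¹' Set.Ioi 1) :=
          (h.measure_inter_tailIntegral hfm x hB measurableSet_Ioi).symm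
        _ ≤ P (B ∩ tailIntegral f ξ x m ⁻¹' Set.Ioi 1) :=
          -- Tails decrease in time, so exceeding 1 at the bad time s implies exceeding 1 at m: a
          -- single event independent of s, as the maximal inequality requires.
          measure_mono (Set.inter_subset_inter_right _ fun ω (hω : _ < _) =>
            show _ < _ from hω.trans_le (tailIntegral_antitone f ξ x ω le_self_add))
  have hlim : Tendsto (fun m : ℕ => P (tailIntegral f ξ x m ⁻¹' Set.Ioi 1)) atTop (𝓝 0) := by
    have := tendsto_measure_iInter_atTop (μ := P)
      (s := fun m : ℕ => tailIntegral f ξ x m ⁻¹' Set.Ioi 1)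
      (fun m => (htm m measurableSet_Ioi).nullMeasurableSet)
      (fun a b hab ω (hω : _ < _) => show _ < _ from
        hω.trans_le (tailIntegral_antitone f ξ x ω (by exact_mod_cast hab)))
      ⟨0, measure_ne_top _ _⟩
    have he : P (⋂ m : ℕ, tailIntegral f ξ x m ⁻¹' Set.Ioi 1) = 0 := by
      refine measure_mono_null (fun ω hω => ?_) (ae_iff.1 hfin)
      intro hlt
      obtain ⟨m, hm⟩ := exists_tailIntegral_le_one hlt
      exact absurd (Set.mem_iInter.1 hω m) (not_lt.2 hm)
    rwa [he] at this
  refine ⟨E, hEc.measurableSet, ?_, ?_⟩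
  · have hzero : 2⁻¹ * P {ω | ¬ ∃ τ : ℝ≥0, ∀ s, τ ≤ s → x + ξ s ω ∈ E} ≤ 0 := by
      refine ge_of_tendsto' hlim fun m => le_trans (mul_le_mul_right (measure_mono ?_) _) (hmax m)
      intro ω hω
      by_contra hcon
      refine hω ⟨m, fun s hs => ?_⟩
      by_contra hlt
      exact hcon ⟨s, hs, hlt⟩
    have := nonpos_iff_eq_zero.1 hzero
    rw [mul_eq_zero] at this
    exact this.resolve_left (by simp)
  · have key := h.mul_setLIntegral_potentialMeasure_le hfm x (c := 2⁻¹) (by simp)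
      hEc.measurableSet (K := 1) fun y hy => hy
    by_contra hcon
    rw [not_lt, top_le_iff] at hcon
    rw [hcon, ENNReal.mul_top (by simp)] at key
    exact absurd key (not_le.2 ENNReal.one_lt_top)

end IsRegularLevy

/-! ### Reduction to regular paths and conclusion -/

/-- Every Lévy process is indistinguishable from a regular one. -/
lemma IsLevyProcess.exists_isRegularLevy {Ω : Type*} [MeasurableSpace Ω] {P : Measure Ω}
    {ξ : ℝ≥0 → Ω → ℝ} (h : IsLevyProcess ξ P) :
    ∃ η : ℝ≥0 → Ω → ℝ, IsRegularLevy η P ∧ ∀ᵐ ω ∂P, ∀ t, η t ω = ξ t ω := by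
  classical
  -- The set of good paths need not be measurable; a measurable subset of full measure is used, and
  -- the process is set to 0 off it.
  obtain ⟨G, hG, hGm, hGsub⟩ := (h.start_zero.and h.right_continuous).exists_measurable_mem
  set η : ℝ≥0 → Ω → ℝ := fun t => G.indicator (ξ t) with hη
  have hae : ∀ᵐ ω ∂P, ∀ t, η t ω = ξ t ω := by
    filter_upwards [hG] with ω hω t
    exact Set.indicator_of_mem hω _
  have hin : ∀ ω ∈ G, ∀ t, η t ω = ξ t ω := fun ω hω t => Set.indicator_of_mem hω _
  have hout : ∀ ω ∉ G, ∀ t, η t ω = 0 := fun ω hω t => Set.indicator_of_notMem hω _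
  have hzero : ∀ ω, η 0 ω = 0 := fun ω => by
    by_cases hω : ω ∈ G
    · rw [hin ω hω]; exact (hGsub ω hω).1
    · exact hout ω hω 0
  have hrc : ∀ ω t, ContinuousWithinAt (fun s => η s ω) (Set.Ici t) t := fun ω t => by
    by_cases hω : ω ∈ G
    · simp only [hin ω hω]; exact (hGsub ω hω).2 t
    · simp only [hout ω hω]; exact continuousWithinAt_const
  refine ⟨η, { measurable := fun t => (h.measurable t).indicator hGm
               start_zero := Eventually.of_forall hzero
               indep_increments := fun n t ht => ?_
               stationary_increments := fun s t => ?_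
               right_continuous := Eventually.of_forall hrc
               zero := hzero
               continuousWithinAt := hrc }, hae⟩
  · refine (h.indep_increments n t ht).congr fun i => ?_
    filter_upwards [hae] with ω hω
    rw [hω, hω]
  · rw [Measure.map_congr (g := fun ω => ξ (s + t) ω - ξ s ω) (by
      filter_upwards [hae] with ω hω
      rw [hω, hω]), Measure.map_congr (f := η t) (g := ξ t) (by
      filter_upwards [hae] with ω hω
      rw [hω])]
    exact h.stationary_increments s t

theorem theorem1 {Ω : Type*} [MeasurableSpace Ω] (P : Measure Ω) [IsProbabilityMeasure P]
    (ξ : ℝ≥0 → Ω → ℝ) (hξ : IsLevyProcess ξ P) (hdrift : DriftsToInfinity ξ P)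
    (f : ℝ → ℝ≥0) (hmeas : Measurable f) (hbdd : LocallyBounded f)
    (hf : Continuous f ∨ UltimatelyNonincreasing f) (x : ℝ) :
    (P {ω | perpetualIntegral f ξ x ω < ∞} = 0 ↔
      ∀ E : Set ℝ, MeasurableSet E → IsTransientSet ξ P x Eᶜ →
        ∫⁻ y in {y | x + y ∈ E}, (f (x + y) : ℝ≥0∞) ∂(potentialMeasure ξ P) = ∞) ∧
    ((∃ E : Set ℝ, MeasurableSet E ∧ IsTransientSet ξ P x Eᶜ ∧
        ∫⁻ y in {y | x + y ∈ E}, (f (x + y) : ℝ≥0∞) ∂(potentialMeasure ξ P) < ∞) →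
      ∀ᵐ ω ∂P, perpetualIntegral f ξ x ω < ∞) := by
  obtain ⟨η, hη, hae⟩ := hξ.exists_isRegularLevy
  have hU : potentialMeasure ξ P = potentialMeasure η P := by
    have : ∀ t, P.map (ξ t) = P.map (η t) := fun t =>
      Measure.map_congr (by filter_upwards [hae] with ω hω; rw [hω])
    simp only [potentialMeasure, this]
  have hI : ∀ᵐ ω ∂P, perpetualIntegral f η x ω = perpetualIntegral f ξ x ω := by
    filter_upwards [hae] with ω hω
    simp only [perpetualIntegral, hω]
  have hdrift' : DriftsToInfinity η P := by
    filter_upwards [hae, hdrift] with ω hω hd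
    simpa only [hω] using hd
  have hPI : P {ω | perpetualIntegral f ξ x ω < ∞} = P {ω | perpetualIntegral f η x ω < ∞} := by
    refine measure_congr ?_
    filter_upwards [hI] with ω hω
    exact propext (by change _ < ∞ ↔ _ < ∞; rw [hω])
  have easy : (∃ E : Set ℝ, MeasurableSet E ∧ IsTransientSet ξ P x Eᶜ ∧
      ∫⁻ y in {y | x + y ∈ E}, (f (x + y) : ℝ≥0∞) ∂(potentialMeasure ξ P) < ∞) →
      ∀ᵐ ω ∂P, perpetualIntegral f ξ x ω < ∞ := by
    rintro ⟨E, hE, ⟨_, htr⟩, hfin⟩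
    rw [hU] at hfin
    have htr' : ∀ᵐ ω ∂P, ∃ τ : ℝ≥0, ∀ s, τ ≤ s → x + η s ω ∈ E := by
      filter_upwards [hae, htr] with ω hω ⟨τ, hτ⟩
      exact ⟨τ, fun s hs => by rw [hω]; simpa using hτ s hs⟩
    filter_upwards [hI, hη.ae_perpetualIntegral_lt_top hmeas hbdd hE htr' hfin] with ω h1 h2
    rwa [← h1]
  refine ⟨⟨fun h0 E hE htr => ?_, fun hall => ?_⟩, easy⟩
  · by_contra hne
    have h1 := easy ⟨E, hE, htr, lt_top_iff_ne_top.2 hne⟩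
    have h2 : ∀ᵐ ω ∂P, ¬ perpetualIntegral f ξ x ω < ∞ := by
      rw [ae_iff]; simpa only [not_not] using h0
    obtain ⟨ω, hω1, hω2⟩ := (h1.and h2).exists
    exact hω2 hω1
  · by_contra hpos
    rw [hPI] at hpos
    obtain ⟨E, hE, htr, hfin⟩ : ∃ E, MeasurableSet E ∧
        (∀ᵐ ω ∂P, ∃ τ : ℝ≥0, ∀ s, τ ≤ s → x + η s ω ∈ E) ∧
        ∫⁻ y in {y | x + y ∈ E}, (f (x + y) : ℝ≥0∞) ∂(potentialMeasure η P) < ∞ := by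
      obtain hc | ⟨l, hl⟩ := hf
      · exact hη.exists_of_continuous hc hbdd hpos
      · exact hη.exists_of_antitoneOn hdrift' hmeas hl hpos
    have htr' : IsTransientSet ξ P x Eᶜ := by
      refine ⟨hE.compl, ?_⟩
      filter_upwards [hae, htr] with ω hω ⟨τ, hτ⟩
      exact ⟨τ, fun s hs => by rw [← hω]; simpa using hτ s hs⟩
    have := hall E hE htr'
    rw [hU] at this
    exact hfin.ne this
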